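/- Let $(X,d)$ be a separable, locally compact metric space and $\mu$ a Borel measure on $X$ with $0<\mu(B(x,r))<\infty$ for all $x\in X$, $r>0$. Let $\mathcal M$ be the set of Borel measures $\nu\le\mu$ with compact support, $\mathcal X=\mathcal M\setminus\{0\}$, and $\|\nu\|=\nu(X)$. Fix a continuous, strictly increasing $\theta:[0,\infty)\to[0,\infty)$ with $\theta(0)=0$, $\lim_{\varepsilon\to0^+}\theta(\varepsilon)/\varepsilon=0$, $\theta(a)+\theta(b)\le\theta(a+b)$ for all $a,b\ge 0$, and $\lim_{\varepsilon\to\infty}\theta(\varepsilon)=\infty$. For $\nu,\eta\in\mathcal M$ let $d_{\mathcal M}(\nu,\eta)$ be the infimum of all $\varepsilon>0$ for which there are at most countable decompositions $\nu=\sum_i\nu_i$, $\eta=\sum_i\eta_i$ with $\nu_i,\eta_i\in\mathcal M$, $\sum_i\bigl|\|\nu_i\|-\|\eta_i\|\bigr|\le\theta(\varepsilon)$ and $\operatorname{diam}(\operatorname{supp}\nu_i\cup\operatorname{supp}\eta_i)\le\varepsilon$ for every $i$. A curve is a map $\gamma:[0,b]\to\mathcal X$, $b\ge0$, which is $1$-Lipschitz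 with respect to $d_{\mathcal M}$. For $F:\mathcal X\to\mathbb R$ and $\eta\in\mathcal X$ put $$r_F(\eta)=\lim_{\varepsilon\to0^+}\ \sup\Bigl\{\frac{|F(\gamma(s))-F(\eta)|}{s}:\ \gamma:[0,b]\to\mathcal X\text{ a curve},\ \gamma(0)=\eta,\ 0<s<\min(\varepsilon,b)\Bigr\}\in[0,\infty],$$ and for $f\in L^1_{\rm loc}(X)$ put $F_f(\eta)=\frac1{\|\eta\|}\int f\,d\eta$. The upper gradient $g_f$ of $f\in L^1_{\rm loc}(X)$, when it exists, is the $\mu$-a.e. smallest $g\in L^1_{\rm loc}(X)$ such that $r_{F_f}\le F_g$ on $\mathcal X$; in particular, $g_f=g$ whenever $r_{F_f}=F_g$ for some $g\in L^1_{\rm loc}(X)$. **Proposition (Leibniz rule).** Let $f,h\in L^1_{\rm loc}(X)$ have upper gradients $g_f,g_h\in L^1_{\rm loc}(X)$, and suppose that $fh\in L^1_{\rm loc}(X)$. 1. If $fh$ has an upper gradient $g_{fh}\in L^1_{\rm loc}(X)$, then $$g_{fh}\le |f|\,g_h+|h|\,g_f\qquad\mu\text{-a.e.}$$ 2. If $|f|\,g_h+|h|\,g_f\in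 L^1_{\rm loc}(X)$, then $fh$ does have an upper gradient $g_{fh}\in L^1_{\rm loc}(X)$ (and hence the inequality in 1 holds). -/

import Mathlib

open MeasureTheory Set Filter Topology
open scoped ENNReal

namespace MassTransport

noncomputable section

/-- The standing assumptions on the function `θ : [0,∞) → [0,∞)` which prices a change of mass
(only the values of `θ` on `[0,∞)` matter). -/
structure IsMassGauge (θ : ℝ → ℝ) : Prop where
  strictMonoOn : StrictMonoOn θ (Ici 0)
  continuousOn : ContinuousOn θ (Ici 0)
  map_zero : θ 0 = 0
  tendsto_div : Tendsto (fun ε => θ ε / ε) (𝓝[>] 0) (𝓝 0)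
  superadditive : ∀ a b : ℝ, 0 ≤ a → 0 ≤ b → θ a + θ b ≤ θ (a + b)
  tendsto_atTop : Tendsto θ atTop atTop

variable {X : Type*} [MetricSpace X] [MeasurableSpace X]

/-- `𝓜`: the measures dominated by `μ` with compact support. -/
def massM (μ : Measure X) : Set (Measure X) :=
  {ν | ν ≤ μ ∧ IsCompact ν.support}

/-- `𝓧 = 𝓜 \ {0}`. -/
def massX (μ : Measure X) : Set (Measure X) := massM μ \ {0}

/-- The sequence of pairs `(νs i, ηs i)` belongs to `Γ_{ε,δ}(ν, η)`. Sequences suffice for at most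
countable index sets: pad with pairs of zero measures, whose support is empty. -/
structure IsDecomposition (μ : Measure X) (ε δ : ℝ) (ν η : Measure X)
    (νs ηs : ℕ → Measure X) : Prop where
  left_mem : ∀ i, νs i ∈ massM μ
  right_mem : ∀ i, ηs i ∈ massM μ
  left_sum : ν = Measure.sum νs
  right_sum : η = Measure.sum ηs
  mass_le : ∑' i, ENNReal.ofReal |(νs i).real univ - (ηs i).real univ| ≤ ENNReal.ofReal δ
  diam_le : ∀ i, Metric.diam ((νs i).support ∪ (ηs i).support) ≤ ε

/-- The distance `d_𝓜(ν, η) = inf {ε > 0 : Γ_{ε,θ(ε)}(ν, η) ≠ ∅}`. -/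
def massDist (θ : ℝ → ℝ) (μ ν η : Measure X) : ℝ :=
  sInf {ε : ℝ | 0 < ε ∧ ∃ νs ηs : ℕ → Measure X, IsDecomposition μ ε (θ ε) ν η νs ηs}

/-- `γ` restricted to `[0,b]` is a curve in `𝓧` subparametrized by arc length, that is, it is
`1`-Lipschitz for `d_𝓜` (hence rectifiable). The values of `γ` outside `[0,b]` play no role. -/
def IsCurve (θ : ℝ → ℝ) (μ : Measure X) (b : ℝ) (γ : ℝ → massX μ) : Prop :=
  0 ≤ b ∧ ∀ s ∈ Icc 0 b, ∀ t ∈ Icc 0 b,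
    massDist θ μ (γ s : Measure X) (γ t : Measure X) ≤ |s - t|

/-- The mean value functional `F_f(η) = ‖η‖⁻¹ ∫ f dη` on `𝓧`. -/
def meanValue (μ : Measure X) (f : X → ℝ) (η : massX μ) : ℝ :=
  ((η : Measure X).real univ)⁻¹ * ∫ x, f x ∂(η : Measure X)

/-- `r_F^ε(η)`, the supremum of `|F(γ(s)) - F(η)| / s` over all curves `γ` in `𝓧` with `γ(0) = η`
and all `0 < s < min ε b_γ`. -/
def slopeAt (θ : ℝ → ℝ) (μ : Measure X) (F : massX μ → ℝ) (ε : ℝ) (η : massX μ) : ℝ≥0∞ :=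
  sSup {v | ∃ (b : ℝ) (γ : ℝ → massX μ) (s : ℝ), IsCurve θ μ b γ ∧ γ 0 = η ∧ 0 < s ∧
    s < min ε b ∧ v = ENNReal.ofReal (|F (γ s) - F η| / s)}

/-- `r_F(η) = lim_{ε → 0} r_F^ε(η)`; since `r_F^ε` decreases as `ε` decreases, the limit is the
infimum over `ε > 0`. -/
def slope (θ : ℝ → ℝ) (μ : Measure X) (F : massX μ → ℝ) (η : massX μ) : ℝ≥0∞ :=
  ⨅ (ε : ℝ) (_ : 0 < ε), slopeAt θ μ F ε η

/-- `g ∈ L¹_loc` dominates the slope of `F_f`: `r_{F_f}(η) ≤ F_g(η)` for all `η ∈ 𝓧`. -/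
def DominatesSlope (θ : ℝ → ℝ) (μ : Measure X) (f g : X → ℝ) : Prop :=
  LocallyIntegrable g μ ∧
    ∀ η : massX μ, (slope θ μ (meanValue μ f) η : EReal) ≤ ((meanValue μ g η : ℝ) : EReal)

/-- `g` is (a representative of) the upper gradient `g_f`: the `μ`-a.e. smallest function in
`L¹_loc` such that `F_g` dominates `r_{F_f}`. By `IsUpperGradient.of_slope_eq` below, any `g` with
`r_{F_f} = F_g` is of this kind. -/
def IsUpperGradient (θ : ℝ → ℝ) (μ : Measure X) (f g : X → ℝ) : Prop :=
  DominatesSlope θ μ f g ∧ ∀ g' : X → ℝ, DominatesSlope θ μ f g' → g ≤ᵐ[μ] g'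

/-- A function in `L¹_loc` is determined, with its order, by its mean values on `𝓧`. -/
theorem ae_le_of_meanValue_le [TopologicalSpace.SeparableSpace X] [LocallyCompactSpace X]
    [BorelSpace X] {μ : Measure X} {g g' : X → ℝ}
    (hg : LocallyIntegrable g μ) (hg' : LocallyIntegrable g' μ)
    (hle : ∀ η : massX μ, meanValue μ g η ≤ meanValue μ g' η) : g ≤ᵐ[μ] g' := by
  have := UniformSpace.secondCountable_of_separable X
  have key : ∀ n, g ≤ᵐ[μ.restrict (compactCovering X n)] g' := by
    intro n
    have hK := isCompact_compactCovering X n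
    refine ae_le_of_forall_setIntegral_le (hg.integrableOn_isCompact hK)
      (hg'.integrableOn_isCompact hK) fun s hs hsf => ?_
    rw [Measure.restrict_restrict hs]
    rw [Measure.restrict_apply hs] at hsf
    by_cases h0 : μ (s ∩ compactCovering X n) = 0
    · simp [Measure.restrict_eq_zero.2 h0]
    have hsupp : (μ.restrict (s ∩ compactCovering X n)).support ⊆ compactCovering X n := by
      refine Measure.support_subset_of_isClosed hK.isClosed ?_
      rw [mem_ae_iff, Measure.restrict_apply hK.isClosed.measurableSet.compl]
      convert measure_empty (μ := μ)
      ext x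
      simpa using fun h _ => h
    have hmem : μ.restrict (s ∩ compactCovering X n) ∈ massX μ :=
      ⟨⟨Measure.restrict_le_self, hK.of_isClosed_subset Measure.isClosed_support hsupp⟩,
        fun h => h0 (Measure.restrict_eq_zero.1 h)⟩
    have h1 := hle ⟨_, hmem⟩
    have hpos : 0 < (μ.restrict (s ∩ compactCovering X n)).real univ := by
      rw [measureReal_restrict_apply_univ]
      exact ENNReal.toReal_pos h0 hsf.ne
    exact le_of_mul_le_mul_left h1 (inv_pos.2 hpos)
  have := (ae_restrict_iUnion_iff (μ := μ) (compactCovering X) (fun x => g x ≤ g' x)).2 key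
  rwa [iUnion_compactCovering, Measure.restrict_univ] at this

/-- If `r_{F_f} = F_g` on `𝓧`, then `g` is the upper gradient of `f`. -/
theorem IsUpperGradient.of_slope_eq [TopologicalSpace.SeparableSpace X] [LocallyCompactSpace X]
    [BorelSpace X] {θ : ℝ → ℝ} {μ : Measure X} {f g : X → ℝ} (hg : LocallyIntegrable g μ)
    (heq : ∀ η : massX μ,
      (slope θ μ (meanValue μ f) η : EReal) = ((meanValue μ g η : ℝ) : EReal)) :
    IsUpperGradient θ μ f g := by
  refine ⟨⟨hg, fun η => (heq η).le⟩, fun g' hg' => ae_le_of_meanValue_le hg hg'.1 fun η => ?_⟩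
  have h := hg'.2 η
  rw [heq η] at h
  exact_mod_cast h

end

end MassTransport

/-! ### Absolutely continuous functions on an interval -/

namespace MassTransport

/-! The inequality `r_{F_f} ≤ F_g` is translated into a statement about single paths, where the
Leibniz rule is the product rule for absolutely continuous functions. A flow (`IsFlow`) is a measure
on `1`-Lipschitz paths in a compact set with marginals at most `μ`. For Borel `f` and Borel `g ≥ 0`,
both locally integrable, slope domination is equivalent to `PathGrad`: along almost every path of
every flow, `f` has an absolutely continuous representative with derivative at most `g`.

From slopes to paths (`DominatesSlope.pathGrad`): the marginals of a flow form a curve, so the mean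
of `f` over the flow grows at most at the rate given by the mean of `g`. Every restriction of a flow
is again a flow, which turns this bound on means into one on almost every path.

From paths to slopes (`PathGrad.dominatesSlope`): every short curve is the marginal curve of a flow
(`IsCurve.exists_flow`). Since `θ ε = o(ε)`, cutting a curve into `n` steps costs a total mass
defect `n θ(C/n) → 0`, so mass is conserved and moves with speed at most `1`. Couplings of
consecutive times are glued into measures on discrete chains, and a compactness limit yields the
measure on paths.

Path bounds are stable under countable infima (`PathGrad.of_countable`). For part 1, the minimum of
`g_{fh}` and `|f| g_h + |h| g_f` is still a path bound, and it is locally integrable because it lies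
between `0` and `g_{fh}`; minimality of `g_{fh}` finishes. For part 2,
`IsPathGradient.exists_minimal` produces a smallest path bound below `|f| g_h + |h| g_f`. -/

theorem _root_.LipschitzWith.comp_absolutelyContinuousOnInterval {φ A : ℝ → ℝ} {a b : ℝ}
    (hφ : LipschitzWith 1 φ) (hA : AbsolutelyContinuousOnInterval A a b) :
    AbsolutelyContinuousOnInterval (φ ∘ A) a b := by
  refine squeeze_zero (fun _ => Finset.sum_nonneg fun _ _ => dist_nonneg) (fun E => ?_) hA
  exact Finset.sum_le_sum fun i _ => by simpa using hφ.dist_le_mul (A (E.2 i).1) (A (E.2 i).2)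

/-- A function on a subset of `[0, T]` whose increments are bounded by the integrals of `a`
extends to an absolutely continuous function with the same property. -/
theorem exists_absolutelyContinuous_extension {T : ℝ} {u a : ℝ → ℝ} {S : Set ℝ}
    (hS : S ⊆ Icc 0 T) (hT : 0 ≤ T) (ha : IntervalIntegrable a volume 0 T) (ha0 : ∀ r, 0 ≤ a r)
    (hu : ∀ t ∈ S, ∀ t' ∈ S, t ≤ t' → |u t' - u t| ≤ ∫ r in t..t', a r) :
    ∃ U : ℝ → ℝ, AbsolutelyContinuousOnInterval U 0 T ∧ EqOn U u S ∧
      ∀ t ∈ Icc 0 T, ∀ t' ∈ Icc 0 T, t ≤ t' → |U t' - U t| ≤ ∫ r in t..t', a r := by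
  set A : ℝ → ℝ := fun t => ∫ r in (0 : ℝ)..t, a r with hA
  have hint : ∀ t ∈ Icc 0 T, ∀ t' ∈ Icc 0 T, IntervalIntegrable a volume t t' := fun t ht t' ht' =>
    ha.mono_set (by
      rw [uIcc_of_le hT]
      exact uIcc_subset_Icc ht ht')
  have h0 : (0 : ℝ) ∈ Icc 0 T := ⟨le_rfl, hT⟩
  have hAsub : ∀ t ∈ Icc 0 T, ∀ t' ∈ Icc 0 T, A t' - A t = ∫ r in t..t', a r := fun t ht t' ht' =>
    intervalIntegral.integral_interval_sub_left (hint _ h0 _ ht') (hint _ h0 _ ht)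
  have hAmono : ∀ t ∈ Icc 0 T, ∀ t' ∈ Icc 0 T, t ≤ t' → 0 ≤ A t' - A t := by
    intro t ht t' ht' hle
    rw [hAsub t ht t' ht']
    exact intervalIntegral.integral_nonneg hle fun r _ => ha0 r
  have key : ∀ t ∈ S, ∀ t' ∈ S, |u t' - u t| ≤ |A t' - A t| := by
    intro t ht t' ht'
    rcases le_total t t' with hle | hle
    · rw [abs_of_nonneg (hAmono t (hS ht) t' (hS ht') hle), hAsub t (hS ht) t' (hS ht')]
      exact hu t ht t' ht' hle
    · rw [abs_sub_comm, abs_sub_comm (A t'), abs_of_nonneg (hAmono t' (hS ht') t (hS ht) hle),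
        hAsub t' (hS ht') t (hS ht)]
      exact hu t' ht' t ht hle
  -- `A` need not be injective on `S`, but by `key` the function `u` is constant on its fibres. So
  -- `u` is a `1`-Lipschitz function of `A`, which extends to the line.
  have hLip : LipschitzOnWith 1 (fun y => u (Function.invFunOn A S y)) (A '' S) := by
    refine LipschitzOnWith.of_dist_le_mul fun y hy z hz => ?_
    rw [NNReal.coe_one, one_mul, Real.dist_eq, Real.dist_eq]
    have := key _ (Function.invFunOn_mem hz) _ (Function.invFunOn_mem hy)
    rwa [Function.invFunOn_eq hz, Function.invFunOn_eq hy] at this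
  obtain ⟨φ, hφ, hφe⟩ := hLip.extend_real
  refine ⟨φ ∘ A, hφ.comp_absolutelyContinuousOnInterval
    (ha.absolutelyContinuousOnInterval_intervalIntegral (by simp)), fun t ht => ?_, ?_⟩
  · have hy : A t ∈ A '' S := mem_image_of_mem A ht
    have h1 := key _ (Function.invFunOn_mem hy) _ ht
    rw [Function.invFunOn_eq hy, sub_self, abs_zero] at h1
    have h2 : u t - u (Function.invFunOn A S (A t)) = 0 := abs_nonpos_iff.1 h1
    have h3 := hφe hy
    simp only at h3
    rw [Function.comp_apply, ← h3]
    linarith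
  · intro t ht t' ht' hle
    have h1 := hφ.dist_le_mul (A t') (A t)
    rw [NNReal.coe_one, one_mul, Real.dist_eq, Real.dist_eq,
      abs_of_nonneg (hAmono t ht t' ht' hle), hAsub t ht t' ht'] at h1
    exact h1

/-- Compare right difference quotients wherever `U` and the primitive of `a` are both
differentiable, the latter with derivative `a` (Lebesgue differentiation). The endpoint `T` is
discarded because it has no right neighbours. -/
theorem ae_abs_deriv_le {T : ℝ} {U a : ℝ → ℝ} (hT : 0 ≤ T) (ha : IntervalIntegrable a volume 0 T)
    (hU : ∀ t ∈ Icc 0 T, ∀ t' ∈ Icc 0 T, t ≤ t' → |U t' - U t| ≤ ∫ r in t..t', a r)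
    (hac : AbsolutelyContinuousOnInterval U 0 T) :
    ∀ᵐ t, t ∈ Icc 0 T → |deriv U t| ≤ a t := by
  have hne : ∀ᵐ t : ℝ, t ≠ T := by simp [ae_iff, measure_singleton]
  filter_upwards [ha.ae_hasDerivAt_integral, hac.ae_differentiableAt, hne] with t h1 h2 h3 ht
  have ht' : t ∈ uIcc 0 T := by rwa [uIcc_of_le hT]
  have d1 := h1 ht' t ht'
  have d2 := (h2 ht').hasDerivAt
  have s1 := (hasDerivAt_iff_tendsto_slope.1 d1).mono_left (nhdsGT_le_nhdsNE t)
  have s2 := ((hasDerivAt_iff_tendsto_slope.1 d2).mono_left (nhdsGT_le_nhdsNE t)).abs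
  refine le_of_tendsto_of_tendsto s2 s1 ?_
  have hlt : t < T := lt_of_le_of_ne ht.2 h3
  filter_upwards [Ioc_mem_nhdsGT hlt] with y hy
  have hpos : 0 < y - t := sub_pos.2 hy.1
  rw [slope_def_field, slope_def_field, abs_div, abs_of_pos hpos, intervalIntegral.integral_same,
    sub_zero]
  gcongr
  exact hU t ht y ⟨ht.1.trans hy.1.le, hy.2⟩ hy.1.le

theorem abs_sub_le_integral_of_deriv_le {T : ℝ} {W m : ℝ → ℝ} (hT : 0 ≤ T)
    (hm : IntervalIntegrable m volume 0 T) (hac : AbsolutelyContinuousOnInterval W 0 T)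
    (h : ∀ᵐ t, t ∈ Icc 0 T → |deriv W t| ≤ m t) : |W T - W 0| ≤ ∫ r in (0 : ℝ)..T, m r := by
  rw [← hac.integral_deriv_eq_sub, ← Real.norm_eq_abs]
  refine intervalIntegral.norm_integral_le_of_norm_le hT ?_ hm
  filter_upwards [h] with t ht h't using ht ⟨h't.1.le, h't.2⟩

/-- Makes the representative of `f` along a path unique, so that several derivative bounds concern
the same function. -/
theorem AbsolutelyContinuousOnInterval.eqOn_of_ae {T : ℝ} {U V u : ℝ → ℝ} (hT : 0 < T)
    (hU : AbsolutelyContinuousOnInterval U 0 T) (hV : AbsolutelyContinuousOnInterval V 0 T)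
    (h1 : ∀ᵐ t, t ∈ Icc 0 T → U t = u t) (h2 : ∀ᵐ t, t ∈ Icc 0 T → V t = u t) :
    EqOn U V (Icc 0 T) := by
  have hU' := hU.continuousOn
  have hV' := hV.continuousOn
  rw [uIcc_of_le hT.le] at hU' hV'
  refine Measure.eqOn_Icc_of_ae_eq volume hT.ne ?_ hU' hV'
  refine (ae_restrict_iff' measurableSet_Icc).2 ?_
  filter_upwards [h1, h2] with t h1 h2 ht
  rw [h1 ht, h2 ht]

end MassTransport

/-! ### Flows: measures on `1`-Lipschitz paths -/

namespace MassTransport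

/-- Comparison of `Φ` and `-Φ` with a primitive of `Ψ`. Only right slopes are controlled, because
curves are followed forward in time. -/
theorem abs_sub_le_integral_of_right_slope {T : ℝ} {Φ Ψ : ℝ → ℝ}
    (hΦ : ContinuousOn Φ (Icc 0 T)) (hΨ : ContinuousOn Ψ (Icc 0 T))
    (h : ∀ t ∈ Ico 0 T, ∀ c, Ψ t < c → ∀ᶠ z in 𝓝[>] t, |Φ z - Φ t| ≤ c * (z - t))
    {s t : ℝ} (hs : 0 ≤ s) (hst : s ≤ t) (ht : t ≤ T) : |Φ t - Φ s| ≤ ∫ r in s..t, Ψ r := by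
  have hsub : Icc s t ⊆ Icc 0 T := Icc_subset_Icc hs ht
  have hΨ' : ContinuousOn Ψ (Icc s t) := hΨ.mono hsub
  -- Extending `Ψ` by constants outside `[s, t]` makes the primitive differentiable at the endpoints
  -- too.
  set B : ℝ → ℝ := fun z => ∫ r in s..z, IccExtend hst ((Icc s t).domRestrict Ψ) r with hB
  have hcont : Continuous (IccExtend hst ((Icc s t).domRestrict Ψ)) :=
    hΨ'.domRestrict.Icc_extend'
  have hBd : ∀ z ∈ Icc s t, HasDerivAt B (Ψ z) z := fun z hz => by
    have := hcont.integral_hasStrictDerivAt s z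
    rw [IccExtend_of_mem hst _ hz] at this
    exact this.hasDerivAt
  have hBt : B t = ∫ r in s..t, Ψ r := by
    refine intervalIntegral.integral_congr fun r hr => ?_
    rw [uIcc_of_le hst] at hr
    exact IccExtend_of_mem hst _ hr
  have hBs : B s = 0 := by simp [hB]
  have main : ∀ σ : ℝ, |σ| = 1 → σ * (Φ t - Φ s) ≤ B t := by
    intro σ hσ
    refine image_le_of_liminf_slope_right_le_deriv_boundary (f := fun z => σ * (Φ z - Φ s))
      (B := B) (B' := Ψ) (a := s) (b := t) ?_ ?_ ?_ ?_ ?_ ⟨hst, le_rfl⟩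
    · exact continuousOn_const.mul ((hΦ.mono hsub).sub continuousOn_const)
    · simp [hBs]
    · exact fun z hz => (hBd z hz).continuousAt.continuousWithinAt
    · exact fun z hz => (hBd z (Ico_subset_Icc_self hz)).hasDerivWithinAt
    · intro z hz r hr
      obtain ⟨c, hc, hcr⟩ := exists_between hr
      refine Eventually.frequently ?_
      filter_upwards [h z ⟨hs.trans hz.1, hz.2.trans_le ht⟩ c hc, self_mem_nhdsWithin] with y hy hzy
      have hpos : 0 < y - z := sub_pos.2 hzy
      rw [slope_def_field, div_lt_iff₀ hpos]
      calc σ * (Φ y - Φ s) - σ * (Φ z - Φ s) = σ * (Φ y - Φ z) := by ring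
        _ ≤ |σ * (Φ y - Φ z)| := le_abs_self _
        _ = |Φ y - Φ z| := by rw [abs_mul, hσ, one_mul]
        _ ≤ c * (y - z) := hy
        _ < r * (y - z) := by gcongr
  rw [← hBt, abs_le]
  constructor
  · linarith [main (-1) (by simp)]
  · linarith [main 1 (by simp)]

variable {X : Type*} [MetricSpace X] [MeasurableSpace X]

/-- A finite measure on a family of `1`-Lipschitz paths in `K`, all of whose one-time marginals
at times in `[0, T]` are dominated by `μ`. -/
structure IsFlow (μ : Measure X) (K : Set X) (T : ℝ) {Ω : Type*} [MeasurableSpace Ω]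
    (P : Measure Ω) (x : ℝ → Ω → X) : Prop where
  finite : IsFiniteMeasure P
  measurable : Measurable fun p : ℝ × Ω => x p.1 p.2
  lipschitz : ∀ ω s t, dist (x s ω) (x t ω) ≤ |s - t|
  mem : ∀ ω t, x t ω ∈ K
  map_le : ∀ t ∈ Icc 0 T, P.map (x t) ≤ μ

namespace IsFlow

variable {μ : Measure X} {K : Set X} {T : ℝ} {Ω : Type*} [MeasurableSpace Ω]
  {P : Measure Ω} {x : ℝ → Ω → X}

theorem measurable_eval (hx : IsFlow μ K T P x) (t : ℝ) : Measurable (x t) :=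
  hx.measurable.comp (measurable_const.prodMk measurable_id)

/-- The localisation device: an inequality between integrals valid for all flows can be tested on
every set of paths. -/
theorem restrict (hx : IsFlow μ K T P x) (A : Set Ω) : IsFlow μ K T (P.restrict A) x where
  finite := by
    have := hx.finite
    infer_instance
  measurable := hx.measurable
  lipschitz := hx.lipschitz
  mem := hx.mem
  map_le t ht := (Measure.map_mono Measure.restrict_le_self (hx.measurable_eval t)).trans
    (hx.map_le t ht)

theorem map_le_restrict [BorelSpace X] (hx : IsFlow μ K T P x) (hK : IsCompact K) {t : ℝ}
    (ht : t ∈ Icc 0 T) : P.map (x t) ≤ μ.restrict K := by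
  refine Measure.le_iff.2 fun s hs => ?_
  rw [Measure.restrict_apply hs]
  refine le_trans (le_of_eq ?_) (hx.map_le t ht _)
  rw [Measure.map_apply (hx.measurable_eval t) hs,
    Measure.map_apply (hx.measurable_eval t) (hs.inter hK.measurableSet)]
  congr 1
  ext ω
  simp [hx.mem]

theorem integrable [BorelSpace X] (hx : IsFlow μ K T P x) (hK : IsCompact K) {g : X → ℝ}
    (hg : IntegrableOn g K μ) {t : ℝ} (ht : t ∈ Icc 0 T) : Integrable (fun ω => g (x t ω)) P :=
  (Integrable.mono_measure hg (hx.map_le_restrict hK ht)).comp_measurable (hx.measurable_eval t)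

theorem integral_map_eval [BorelSpace X] (hx : IsFlow μ K T P x) (hK : IsCompact K) {g : X → ℝ}
    (hg : IntegrableOn g K μ) {t : ℝ} (ht : t ∈ Icc 0 T) :
    ∫ y, g y ∂(P.map (x t)) = ∫ ω, g (x t ω) ∂P :=
  integral_map (hx.measurable_eval t).aemeasurable
    (Integrable.mono_measure hg (hx.map_le_restrict hK ht)).aestronglyMeasurable

theorem integral_norm_le [BorelSpace X] (hx : IsFlow μ K T P x) (hK : IsCompact K) {g : X → ℝ}
    (hg : IntegrableOn g K μ) {t : ℝ} (ht : t ∈ Icc 0 T) :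
    ∫ ω, ‖g (x t ω)‖ ∂P ≤ ∫ y in K, ‖g y‖ ∂μ := by
  rw [← hx.integral_map_eval hK hg.norm ht]
  exact integral_mono_measure (hx.map_le_restrict hK ht) (ae_of_all _ fun _ => norm_nonneg _)
    hg.norm

/-- The mean of an integrable function along a flow is continuous in time, with a modulus
of continuity which only depends on the compact set and on a bound for the mass of the flow. -/
theorem exists_modulus [BorelSpace X] [SecondCountableTopology X] [IsFiniteMeasureOnCompacts μ]
    (hK : IsCompact K) {g : X → ℝ} (hg : IntegrableOn g K μ) (M : ℝ) {δ : ℝ} (hδ : 0 < δ) :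
    ∃ ε > 0, ∀ {Ω : Type*} [MeasurableSpace Ω] {P : Measure Ω} {x : ℝ → Ω → X} {T : ℝ},
      IsFlow μ K T P x → P.real univ ≤ M → ∀ s ∈ Icc 0 T, ∀ t ∈ Icc 0 T, |s - t| < ε →
        |∫ ω, g (x s ω) ∂P - ∫ ω, g (x t ω) ∂P| ≤ δ := by
  have : IsFiniteMeasure (μ.restrict K) := isFiniteMeasure_restrict.2 hK.measure_lt_top.ne
  -- Replacing `g` by `φ` costs at most `δ / 4` at each time, for every flow, since all marginals
  -- are below `μ` restricted to `K`. The middle term uses the uniform continuity of `φ` on `K`; the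
  -- `+ 1` in `M'` allows division by it.
  obtain ⟨φ, hφ, hφi⟩ := Integrable.exists_boundedContinuous_integral_sub_le hg
    (show 0 < δ / 4 by positivity)
  have huc := hK.uniformContinuousOn_of_continuous φ.continuous.continuousOn
  set M' := max M 0 + 1
  have hM' : 0 < M' := by positivity
  obtain ⟨ε, hε, hε'⟩ := Metric.uniformContinuousOn_iff.1 huc (δ / (2 * M')) (by positivity)
  refine ⟨ε, hε, fun {Ω} _ {P x T} hx hM s hs t ht hst => ?_⟩
  have := hx.finite
  have hsub : ∀ r ∈ Icc 0 T,
      |∫ ω, g (x r ω) ∂P - ∫ ω, φ (x r ω) ∂P| ≤ δ / 4 := by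
    intro r hr
    rw [← integral_sub (hx.integrable hK hg hr) (hx.integrable hK hφi hr)]
    refine (abs_integral_le_integral_abs).trans (le_trans ?_ hφ)
    exact hx.integral_norm_le hK (g := fun y => g y - φ y) (hg.sub hφi) hr
  have hmid : |∫ ω, φ (x s ω) ∂P - ∫ ω, φ (x t ω) ∂P| ≤ δ / 2 := by
    rw [← integral_sub (hx.integrable hK hφi hs) (hx.integrable hK hφi ht)]
    have h1 := norm_integral_le_of_norm_le_const (μ := P)
      (f := fun ω => φ (x s ω) - φ (x t ω)) (C := δ / (2 * M')) (ae_of_all _ fun ω => by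
        have := hε' _ (hx.mem ω s) _ (hx.mem ω t) ((hx.lipschitz ω s t).trans_lt hst)
        rw [Real.dist_eq] at this
        exact this.le)
    rw [Real.norm_eq_abs] at h1
    refine h1.trans ?_
    have h2 : P.real univ ≤ M' := hM.trans ((le_max_left M 0).trans (le_add_of_nonneg_right zero_le_one))
    calc δ / (2 * M') * P.real univ ≤ δ / (2 * M') * M' := by gcongr
      _ = δ / 2 := by field_simp
  have e1 := hsub s hs
  have e2 := hsub t ht
  rw [abs_le] at *
  constructor <;> linarith

theorem continuousOn_integral [BorelSpace X] [SecondCountableTopology X]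
    [IsFiniteMeasureOnCompacts μ] (hx : IsFlow μ K T P x) (hK : IsCompact K) {g : X → ℝ}
    (hg : IntegrableOn g K μ) : ContinuousOn (fun t => ∫ ω, g (x t ω) ∂P) (Icc 0 T) := by
  refine Metric.continuousOn_iff.2 fun t ht δ hδ => ?_
  obtain ⟨ε, hε, h⟩ := exists_modulus hK hg (P.real univ) (half_pos hδ)
  refine ⟨ε, hε, fun s hs hst => ?_⟩
  rw [Real.dist_eq] at hst ⊢
  exact (h hx le_rfl s hs t ht hst).trans_lt (half_lt_self hδ)

/-- The mean of an integrable function over the paths and over an interval of times. -/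
theorem integrable_prod [BorelSpace X] (hx : IsFlow μ K T P x) (hK : IsCompact K) {g : X → ℝ}
    (hgm : Measurable g) (hg : IntegrableOn g K μ) {s t : ℝ} (hs : 0 ≤ s) (ht : t ≤ T) :
    Integrable (Function.uncurry fun r ω => g (x r ω)) ((volume.restrict (Ioc s t)).prod P) := by
  have := hx.finite
  have hmem : ∀ᵐ r ∂(volume.restrict (Ioc s t)), r ∈ Icc 0 T := by
    refine (ae_restrict_iff' measurableSet_Ioc).2 (ae_of_all _ fun r hr => ?_)
    exact ⟨hs.trans hr.1.le, hr.2.trans ht⟩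
  have hm : Measurable (Function.uncurry fun r ω => g (x r ω)) := hgm.comp hx.measurable
  refine (integrable_prod_iff hm.aestronglyMeasurable).2 ⟨?_, ?_⟩
  · filter_upwards [hmem] with r hr using hx.integrable hK hg hr
  · refine Integrable.of_bound (C := ∫ y in K, ‖g y‖ ∂μ)
      (hm.norm.stronglyMeasurable.integral_prod_right.aestronglyMeasurable) ?_
    filter_upwards [hmem] with r hr
    rw [Real.norm_of_nonneg (integral_nonneg fun _ => norm_nonneg _)]
    exact hx.integral_norm_le hK hg hr

theorem integral_integral_swap [BorelSpace X] (hx : IsFlow μ K T P x) (hK : IsCompact K)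
    {g : X → ℝ} (hgm : Measurable g) (hg : IntegrableOn g K μ) {s t : ℝ} (hs : 0 ≤ s)
    (hst : s ≤ t) (ht : t ≤ T) :
    ∫ r in s..t, ∫ ω, g (x r ω) ∂P = ∫ ω, (∫ r in s..t, g (x r ω)) ∂P := by
  have := hx.finite
  simp only [intervalIntegral.integral_of_le hst]
  exact MeasureTheory.integral_integral_swap (hx.integrable_prod hK hgm hg hs ht)

theorem ae_intervalIntegrable [BorelSpace X] (hx : IsFlow μ K T P x) (hK : IsCompact K)
    {g : X → ℝ} (hgm : Measurable g) (hg : IntegrableOn g K μ) (hT : 0 ≤ T) :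
    ∀ᵐ ω ∂P, IntervalIntegrable (fun r => g (x r ω)) volume 0 T := by
  have := hx.finite
  filter_upwards [(hx.integrable_prod hK hgm hg le_rfl le_rfl).prod_left_ae] with ω hω
  exact (intervalIntegrable_iff_integrableOn_Ioc_of_le hT).2 hω

theorem support_subset [BorelSpace X] (hx : IsFlow μ K T P x) (hK : IsCompact K) (t : ℝ) :
    (P.map (x t)).support ⊆ K := by
  refine Measure.support_subset_of_isClosed hK.isClosed ?_
  rw [mem_ae_map_iff (hx.measurable_eval t).aemeasurable hK.measurableSet]
  exact univ_mem' fun ω => hx.mem ω t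

theorem map_mem_massM [BorelSpace X] (hx : IsFlow μ K T P x) (hK : IsCompact K) {t : ℝ}
    (ht : t ∈ Icc 0 T) : P.map (x t) ∈ massM μ :=
  ⟨hx.map_le t ht, hK.of_isClosed_subset Measure.isClosed_support (hx.support_subset hK t)⟩

theorem map_mem_massX [BorelSpace X] (hx : IsFlow μ K T P x) (hK : IsCompact K) (hP : P ≠ 0)
    {t : ℝ} (ht : t ∈ Icc 0 T) : P.map (x t) ∈ massX μ :=
  ⟨hx.map_mem_massM hK ht, fun h =>
    hP ((Measure.map_eq_zero_iff (hx.measurable_eval t).aemeasurable).1 h)⟩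

/-- Sort the paths by the small cell of `X × X` containing their positions at times `s` and `t`.
Both pieces attached to a cell carry exactly the same mass, so the mass defect is zero, and their
joint diameter is at most `|s - t| + δ`. -/
theorem massDist_le [BorelSpace X] [SecondCountableTopology X] (hx : IsFlow μ K T P x)
    (hK : IsCompact K) {θ : ℝ → ℝ} {s t : ℝ} (hs : s ∈ Icc 0 T)
    (ht : t ∈ Icc 0 T) : massDist θ μ (P.map (x s)) (P.map (x t)) ≤ |s - t| := by
  have := hx.finite
  refine le_of_forall_pos_le_add fun δ hδ => ?_
  refine csInf_le ⟨0, fun ε hε => hε.1.le⟩ ⟨by positivity, ?_⟩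
  obtain ⟨U, hUm, hUb, hUd, hUu, hUdis⟩ :=
    SeparableSpace.exists_measurable_partition_diam_le (X × X) hδ
  have hms := hx.measurable_eval s
  have hmt := hx.measurable_eval t
  have hpair : Measurable fun ω => (x s ω, x t ω) := hms.prodMk hmt
  set A : ℕ → Set Ω := fun i => (fun ω => (x s ω, x t ω)) ⁻¹' U i with hA
  have hAm : ∀ i, MeasurableSet (A i) := fun i => hpair (hUm i)
  have hPsum : P = Measure.sum fun i => P.restrict (A i) := by
    rw [← Measure.restrict_iUnion _ hAm, ← preimage_iUnion, hUu, preimage_univ,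
      Measure.restrict_univ]
    exact fun i j hij => (hUdis hij).preimage _
  have hclose : ∀ i, ∀ ω ∈ A i, ∀ ω' ∈ A i,
      dist (x s ω) (x s ω') ≤ δ ∧ dist (x t ω) (x t ω') ≤ δ := by
    intro i ω hω ω' hω'
    have := (Metric.dist_le_diam_of_mem (hUb i) hω hω').trans (hUd i)
    exact max_le_iff.1 this
  have hsupp : ∀ i r, ((P.restrict (A i)).map (x r)).support ⊆ closure (x r '' A i) := by
    intro i r
    refine Measure.support_subset_of_isClosed isClosed_closure ?_
    rw [mem_ae_map_iff (hx.measurable_eval r).aemeasurable isClosed_closure.measurableSet]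
    filter_upwards [ae_restrict_mem (hAm i)] with ω hω
    exact subset_closure (mem_image_of_mem _ hω)
  refine ⟨fun i => (P.restrict (A i)).map (x s), fun i => (P.restrict (A i)).map (x t),
    fun i => (hx.restrict (A i)).map_mem_massM hK hs,
    fun i => (hx.restrict (A i)).map_mem_massM hK ht, ?_, ?_, ?_, fun i => ?_⟩
  · conv_lhs => rw [hPsum]
    rw [Measure.map_sum hms.aemeasurable]
  · conv_lhs => rw [hPsum]
    rw [Measure.map_sum hmt.aemeasurable]
  · simp [measureReal_def, Measure.map_apply hms, Measure.map_apply hmt]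
  · have hsub : (Measure.map (x s) (P.restrict (A i))).support ∪
        (Measure.map (x t) (P.restrict (A i))).support ⊆
        closure (x s '' A i ∪ x t '' A i) := by
      rw [closure_union]
      exact union_subset_union (hsupp i s) (hsupp i t)
    have hle : ∀ p ∈ x s '' A i ∪ x t '' A i, ∀ q ∈ x s '' A i ∪ x t '' A i,
        dist p q ≤ |s - t| + δ := by
      have hab := abs_nonneg (s - t)
      rintro _ (⟨ω, hω, rfl⟩ | ⟨ω, hω, rfl⟩) _ (⟨ω', hω', rfl⟩ | ⟨ω', hω', rfl⟩)
      · linarith [(hclose i ω hω ω' hω').1]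
      · linarith [(hclose i ω hω ω' hω').1, hx.lipschitz ω' s t,
          dist_triangle (x s ω) (x s ω') (x t ω')]
      · linarith [(hclose i ω hω ω' hω').1, hx.lipschitz ω t s, abs_sub_comm s t,
          dist_triangle (x t ω) (x s ω) (x s ω')]
      · linarith [(hclose i ω hω ω' hω').2]
    have hbdd : Bornology.IsBounded (x s '' A i ∪ x t '' A i) :=
      Metric.isBounded_iff.2 ⟨_, fun p hp q hq => hle p hp q hq⟩
    refine (Metric.diam_mono hsub hbdd.closure).trans ?_
    rw [Metric.diam_closure]
    exact Metric.diam_le_of_forall_dist_le (by positivity) hle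

end IsFlow

end MassTransport

/-! ### Gradients along paths, and their derivation from slope bounds -/

namespace MassTransport

universe u

/-- Along almost every path of every flow, `f` coincides with an absolutely continuous function
whose derivative is bounded by `g`. -/
def PathGrad {X : Type u} [MetricSpace X] [MeasurableSpace X] (μ : Measure X) (f g : X → ℝ) :
    Prop :=
  ∀ (K : Set X) (T : ℝ) (Ω : Type u) [MeasurableSpace Ω] (P : Measure Ω) (x : ℝ → Ω → X),
    IsCompact K → 0 < T → IsFlow μ K T P x → ∀ᵐ ω ∂P, ∃ U : ℝ → ℝ,
      AbsolutelyContinuousOnInterval U 0 T ∧ U 0 = f (x 0 ω) ∧ U T = f (x T ω) ∧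
      (∀ᵐ t, t ∈ Icc 0 T → U t = f (x t ω)) ∧ ∀ᵐ t, t ∈ Icc 0 T → |deriv U t| ≤ g (x t ω)

variable {X : Type u} [MetricSpace X] [MeasurableSpace X] {μ : Measure X} {f g h gf gh : X → ℝ}

/-- The Leibniz rule along paths. -/
theorem PathGrad.mul (hf : PathGrad μ f gf) (hh : PathGrad μ h gh) :
    PathGrad μ (fun y => f y * h y) fun y => |f y| * gh y + |h y| * gf y := by
  intro K T Ω _ P x hK hT hx
  filter_upwards [hf K T Ω P x hK hT hx, hh K T Ω P x hK hT hx] with ω hU hV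
  obtain ⟨U, hU, hU0, hUT, hUe, hUd⟩ := hU
  obtain ⟨V, hV, hV0, hVT, hVe, hVd⟩ := hV
  refine ⟨fun t => U t * V t, hU.fun_mul hV, by simp only [hU0, hV0], by simp only [hUT, hVT],
    ?_, ?_⟩
  · filter_upwards [hUe, hVe] with t h1 h2 ht
    rw [h1 ht, h2 ht]
  · filter_upwards [hUe, hVe, hUd, hVd, hU.ae_differentiableAt, hV.ae_differentiableAt]
      with t h1 h2 h3 h4 h5 h6 ht
    have ht' : t ∈ uIcc 0 T := by rwa [uIcc_of_le hT.le]
    have e : deriv (fun t => U t * V t) t = deriv U t * V t + U t * deriv V t :=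
      ((h5 ht').hasDerivAt.mul (h6 ht').hasDerivAt).deriv
    rw [e, ← h1 ht, ← h2 ht, add_comm]
    refine (abs_add_le _ _).trans ?_
    rw [abs_mul, abs_mul, mul_comm |deriv U t|]
    gcongr
    · rw [h1 ht, h2 ht] at *
      exact h4 ht
    · exact h3 ht

/-- The bounds of `PathGrad` are stable under countable infima. -/
theorem PathGrad.of_countable {ι : Type*} [Countable ι] [Nonempty ι] {G : ι → X → ℝ}
    (hG : ∀ i, PathGrad μ f (G i)) (hg : ∀ y c, (∀ i, c ≤ G i y) → c ≤ g y) :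
    PathGrad μ f g := by
  intro K T Ω _ P x hK hT hx
  filter_upwards [ae_all_iff.2 fun i => hG i K T Ω P x hK hT hx] with ω hω
  choose U hU hU0 hUT hUe hUd using hω
  obtain ⟨j⟩ := ‹Nonempty ι›
  refine ⟨U j, hU j, hU0 j, hUT j, hUe j, ?_⟩
  have hn0 : ∀ᵐ t : ℝ, t ≠ 0 := by simp [ae_iff, measure_singleton]
  have hnT : ∀ᵐ t : ℝ, t ≠ T := by simp [ae_iff, measure_singleton]
  filter_upwards [ae_all_iff.2 hUd, hn0, hnT] with t ht h0 h1 htT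
  refine hg _ _ fun i => ?_
  -- Both representatives are continuous and agree almost everywhere with `f` along the path, so
  -- they coincide on `[0, T]`, a neighbourhood of the interior point `t`.
  have heq : U j =ᶠ[𝓝 t] U i := by
    filter_upwards [Icc_mem_nhds (lt_of_le_of_ne htT.1 h0.symm) (lt_of_le_of_ne htT.2 h1)]
      with r hr
    exact AbsolutelyContinuousOnInterval.eqOn_of_ae hT (hU j) (hU i) (hUe j) (hUe i) hr
  rw [heq.deriv_eq]
  exact ht i htT

variable [BorelSpace X] [SecondCountableTopology X] {θ : ℝ → ℝ}

theorem real_univ_pos_of_ne_zero {Ω : Type*} [MeasurableSpace Ω] {P : Measure Ω}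
    [IsFiniteMeasure P] (hP : P ≠ 0) : 0 < P.real univ := by
  rw [measureReal_def, ENNReal.toReal_pos_iff]
  exact ⟨Measure.measure_univ_pos.2 hP, measure_lt_top _ _⟩

/-- The marginals after time `t` form an admissible curve in the definition of the slope. Their mass
is constant, so mean values are integrals over the flow up to a common factor. -/
theorem DominatesSlope.eventually_abs_integral_sub_le (hdom : DominatesSlope θ μ f g)
    (hf : LocallyIntegrable f μ) {K : Set X} {T : ℝ} {Ω : Type*} [MeasurableSpace Ω]
    {P : Measure Ω} {x : ℝ → Ω → X} (hK : IsCompact K) (hx : IsFlow μ K T P x)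
    {t : ℝ} (ht : t ∈ Ico 0 T) {c : ℝ} (hc : ∫ ω, g (x t ω) ∂P < c) :
    ∀ᶠ z in 𝓝[>] t, |∫ ω, f (x z ω) ∂P - ∫ ω, f (x t ω) ∂P| ≤ c * (z - t) := by
  have := hx.finite
  have hfK := hf.integrableOn_isCompact hK
  have hgK := hdom.1.integrableOn_isCompact hK
  -- The zero measure is not in `𝓧`, yet it does occur, as the restriction of a flow to a null set.
  rcases eq_or_ne P 0 with rfl | hP
  · simp only [integral_zero_measure] at hc ⊢
    filter_upwards [self_mem_nhdsWithin] with z hz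
    simpa using mul_nonneg hc.le (sub_nonneg.2 (le_of_lt hz))
  have hT : 0 ≤ T := ht.1.trans ht.2.le
  set M := P.real univ
  have hM : 0 < M := real_univ_pos_of_ne_zero hP
  have hmass : ∀ r, (P.map (x r)).real univ = M := fun r => by
    rw [measureReal_def, Measure.map_apply (hx.measurable_eval r) MeasurableSet.univ, preimage_univ,
      ← measureReal_def]
  -- The projection onto `[0, T]` keeps the values in `𝓧` at all real times; only `[0, T - t]`
  -- matters.
  set γ : ℝ → massX μ := fun r =>
    ⟨P.map (x (projIcc 0 T hT (t + r))), hx.map_mem_massX hK hP (projIcc 0 T hT (t + r)).2⟩ with hγ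
  have hγe : ∀ r, (ht : t + r ∈ Icc 0 T) → (γ r : Measure X) = P.map (x (t + r)) := fun r hr => by
    simp only [hγ, projIcc_of_mem hT hr]
  have hγm : ∀ r, t + r ∈ Icc 0 T → ∀ {k : X → ℝ}, IntegrableOn k K μ →
      meanValue μ k (γ r) = M⁻¹ * ∫ ω, k (x (t + r) ω) ∂P := fun r hr k hk => by
    rw [meanValue, hγe r hr, hmass, hx.integral_map_eval hK hk hr]
  have ht0 : t + 0 ∈ Icc 0 T := by
    rw [add_zero]
    exact ⟨ht.1, ht.2.le⟩
  have hcurve : IsCurve θ μ (T - t) γ := by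
    refine ⟨sub_nonneg.2 ht.2.le, fun r hr s hs => ?_⟩
    have hr' : t + r ∈ Icc 0 T := ⟨add_nonneg ht.1 hr.1, by linarith [hr.2]⟩
    have hs' : t + s ∈ Icc 0 T := ⟨add_nonneg ht.1 hs.1, by linarith [hs.2]⟩
    rw [hγe r hr', hγe s hs']
    refine (hx.massDist_le hK hr' hs').trans (le_of_eq ?_)
    congr 1
    ring
  have hslope := hdom.2 (γ 0)
  rw [hγm 0 ht0 hgK, add_zero] at hslope
  have hlt : slope θ μ (meanValue μ f) (γ 0) < ENNReal.ofReal (M⁻¹ * c) := by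
    rw [← EReal.coe_ennreal_lt_coe_ennreal_iff]
    refine hslope.trans_lt ?_
    rw [EReal.coe_ennreal_ofReal, EReal.coe_lt_coe_iff]
    exact lt_max_of_lt_left (mul_lt_mul_of_pos_left hc (inv_pos.2 hM))
  obtain ⟨ε, hε⟩ := iInf_lt_iff.1 hlt
  obtain ⟨hε0, hε⟩ := iInf_lt_iff.1 hε
  have hcpos : 0 < M⁻¹ * c := ENNReal.ofReal_pos.1 (bot_le.trans_lt hlt)
  filter_upwards [Ioo_mem_nhdsGT (show t < t + min ε (T - t) by
    have := lt_min hε0 (sub_pos.2 ht.2)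
    linarith)] with z hz
  have hz0 : 0 < z - t := sub_pos.2 hz.1
  have hzm : z - t < min ε (T - t) := by linarith [hz.2]
  have hzT : t + (z - t) ∈ Icc 0 T :=
    ⟨by linarith [ht.1], by linarith [hzm.trans_le (min_le_right _ _)]⟩
  have h1 : ENNReal.ofReal (|meanValue μ f (γ (z - t)) - meanValue μ f (γ 0)| / (z - t)) ≤
      slopeAt θ μ (meanValue μ f) ε (γ 0) :=
    le_sSup ⟨T - t, γ, z - t, hcurve, rfl, hz0, hzm, rfl⟩
  have h2 := (ENNReal.ofReal_le_ofReal_iff hcpos.le).1 (h1.trans hε.le)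
  rw [hγm _ hzT hfK, hγm 0 ht0 hfK, add_zero, div_le_iff₀ hz0, ← mul_sub, abs_mul,
    abs_of_pos (inv_pos.2 hM), mul_assoc, add_sub_cancel] at h2
  exact le_of_mul_le_mul_left h2 (inv_pos.2 hM)

variable [IsFiniteMeasureOnCompacts μ]

theorem DominatesSlope.abs_integral_sub_le (hdom : DominatesSlope θ μ f g)
    (hf : LocallyIntegrable f μ) {K : Set X} {T : ℝ} {Ω : Type*} [MeasurableSpace Ω]
    {P : Measure Ω} {x : ℝ → Ω → X} (hK : IsCompact K) (hx : IsFlow μ K T P x)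
    {s t : ℝ} (hs : 0 ≤ s) (hst : s ≤ t) (ht : t ≤ T) :
    |∫ ω, f (x t ω) ∂P - ∫ ω, f (x s ω) ∂P| ≤ ∫ r in s..t, (∫ ω, g (x r ω) ∂P) :=
  abs_sub_le_integral_of_right_slope (Φ := fun t => ∫ ω, f (x t ω) ∂P)
    (Ψ := fun t => ∫ ω, g (x t ω) ∂P)
    (hx.continuousOn_integral hK (hf.integrableOn_isCompact hK))
    (hx.continuousOn_integral hK (hdom.1.integrableOn_isCompact hK))
    (fun _ ht _ hc => hdom.eventually_abs_integral_sub_le hf hK hx ht hc) hs hst ht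

/-- Restrict the flow to an arbitrary set of paths and exchange the integrals over times and paths;
comparing set integrals then gives the bound path by path. The exceptional null set still depends on
`s` and `t`. -/
theorem DominatesSlope.ae_abs_sub_le (hdom : DominatesSlope θ μ f g)
    (hf : LocallyIntegrable f μ) (hgm : Measurable g) {K : Set X} {T : ℝ} {Ω : Type*}
    [MeasurableSpace Ω] {P : Measure Ω} {x : ℝ → Ω → X} (hK : IsCompact K) (hx : IsFlow μ K T P x)
    {s t : ℝ} (hs : 0 ≤ s) (hst : s ≤ t) (ht : t ≤ T) :
    ∀ᵐ ω ∂P, |f (x t ω) - f (x s ω)| ≤ ∫ r in s..t, g (x r ω) := by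
  have := hx.finite
  have hfK := hf.integrableOn_isCompact hK
  have hgK := hdom.1.integrableOn_isCompact hK
  have hft := hx.integrable hK hfK ⟨hs.trans hst, ht⟩
  have hfs := hx.integrable hK hfK ⟨hs, hst.trans ht⟩
  have hgi : Integrable (fun ω => ∫ r in s..t, g (x r ω)) P := by
    simp only [intervalIntegral.integral_of_le hst]
    exact (hx.integrable_prod hK hgm hgK hs ht).integral_prod_right
  have key : ∀ A : Set Ω,
      |∫ ω in A, f (x t ω) - f (x s ω) ∂P| ≤ ∫ ω in A, (∫ r in s..t, g (x r ω)) ∂P := by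
    intro A
    have hA := hx.restrict A
    rw [integral_sub hft.restrict hfs.restrict,
      ← hA.integral_integral_swap hK hgm hgK hs hst ht]
    exact hdom.abs_integral_sub_le hf hK hA hs hst ht
  have h1 := ae_le_of_forall_setIntegral_le (hft.sub hfs) hgi
    fun A _ _ => (le_abs_self _).trans (key A)
  have h2 := ae_le_of_forall_setIntegral_le (hft.sub hfs).neg hgi fun A _ _ => by
    simp only [Pi.neg_apply, Pi.sub_apply, integral_neg]
    exact (neg_le_abs _).trans (key A)
  filter_upwards [h1, h2] with ω h1 h2
  exact abs_le'.2 ⟨h1, h2⟩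

/-- One null set of paths must serve uncountably many times. Pairs of times in a countable dense set
`D` are handled by a countable union, and a time of `D` with almost every time by Fubini. This gives
a set `S` of times of full measure, on which increments are compared through a rational time in
between. -/
theorem DominatesSlope.pathGrad (hdom : DominatesSlope θ μ f g) (hf : LocallyIntegrable f μ)
    (hfm : Measurable f) (hgm : Measurable g) (hg0 : ∀ y, 0 ≤ g y) : PathGrad μ f g := by
  intro K T Ω _ P x hK hT hx
  have := hx.finite
  have hgK := hdom.1.integrableOn_isCompact hK
  -- The indicator makes the domain of integration independent of `t`, whence joint measurability in
  -- `(t, ω)`.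
  set A : ℝ → Ω → ℝ := fun t ω => ∫ r, (Ioc 0 t).indicator (fun r => g (x r ω)) r with hA
  have hAe : ∀ t, 0 ≤ t → ∀ ω, A t ω = ∫ r in (0 : ℝ)..t, g (x r ω) := fun t ht ω => by
    rw [intervalIntegral.integral_of_le ht, ← integral_indicator measurableSet_Ioc]
  have hAm : Measurable fun p : ℝ × Ω => A p.1 p.2 := by
    have hm : Measurable fun p : (ℝ × Ω) × ℝ =>
        (Ioc 0 p.1.1).indicator (fun r => g (x r p.1.2)) p.2 := by
      have h1 : Measurable fun p : (ℝ × Ω) × ℝ => g (x p.2 p.1.2) :=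
        hgm.comp (hx.measurable.comp (measurable_snd.prodMk (measurable_snd.comp measurable_fst)))
      have h2 : MeasurableSet {p : (ℝ × Ω) × ℝ | p.2 ∈ Ioc 0 p.1.1} :=
        (measurableSet_lt measurable_const measurable_snd).inter
          (measurableSet_le measurable_snd (measurable_fst.comp measurable_fst))
      exact h1.indicator h2
    exact hm.stronglyMeasurable.integral_prod_right.measurable
  -- The endpoints are included because the representative must equal `f` there exactly, not just
  -- almost everywhere.
  set D : Set ℝ := Icc 0 T ∩ (insert 0 (insert T (range fun q : ℚ => (q : ℝ)))) with hD
  have hDc : D.Countable := (((countable_range _).insert _).insert _).mono inter_subset_right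
  have hbound : ∀ s ∈ Icc 0 T, ∀ t ∈ Icc 0 T,
      ∀ᵐ ω ∂P, |f (x t ω) - f (x s ω)| ≤ |A t ω - A s ω| := by
    have main : ∀ s ∈ Icc 0 T, ∀ t ∈ Icc 0 T, s ≤ t →
        ∀ᵐ ω ∂P, |f (x t ω) - f (x s ω)| ≤ |A t ω - A s ω| := by
      intro s hs t ht hst
      filter_upwards [hdom.ae_abs_sub_le hf hgm hK hx hs.1 hst ht.2,
        hx.ae_intervalIntegrable hK hgm hgK hT.le] with ω h1 h2
      refine h1.trans (le_trans (le_of_eq ?_) (le_abs_self _))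
      rw [hAe t ht.1, hAe s hs.1, intervalIntegral.integral_interval_sub_left]
      · exact h2.mono_set (uIcc_subset_uIcc_left (by rwa [uIcc_of_le hT.le]))
      · exact h2.mono_set (uIcc_subset_uIcc_left (by rwa [uIcc_of_le hT.le]))
    intro s hs t ht
    rcases le_total s t with hst | hst
    · exact main s hs t ht hst
    · filter_upwards [main t ht s hs hst] with ω hω
      rwa [abs_sub_comm, abs_sub_comm (A t ω)]
  have hDD : ∀ᵐ ω ∂P, ∀ s ∈ D, ∀ t ∈ D, |f (x t ω) - f (x s ω)| ≤ |A t ω - A s ω| :=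
    (ae_ball_iff hDc).2 fun s hs => (ae_ball_iff hDc).2 fun t ht => hbound s hs.1 t ht.1
  have hDt : ∀ᵐ ω ∂P, ∀ s ∈ D, ∀ᵐ t ∂(volume.restrict (Icc 0 T)),
      |f (x t ω) - f (x s ω)| ≤ |A t ω - A s ω| := by
    refine (ae_ball_iff hDc).2 fun s hs => ?_
    have hms : MeasurableSet {p : ℝ × Ω |
        |f (x p.1 p.2) - f (x s p.2)| ≤ |A p.1 p.2 - A s p.2|} := by
      refine measurableSet_le ?_ ?_
      · exact ((hfm.comp hx.measurable).sub
          (hfm.comp ((hx.measurable_eval s).comp measurable_snd))).abs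
      · exact (hAm.sub (hAm.comp (measurable_const.prodMk measurable_snd))).abs
    refine (Measure.ae_ae_comm hms).1 ?_
    filter_upwards [ae_restrict_mem measurableSet_Icc] with t ht using hbound s hs.1 t ht
  filter_upwards [hDD, hDt, hx.ae_intervalIntegrable hK hgm hgK hT.le] with ω h1 h2 h3
  have hAsub : ∀ s ∈ Icc 0 T, ∀ t ∈ Icc 0 T, A t ω - A s ω = ∫ r in s..t, g (x r ω) := by
    intro s hs t ht
    rw [hAe t ht.1, hAe s hs.1, intervalIntegral.integral_interval_sub_left]
    · exact h3.mono_set (uIcc_subset_uIcc_left (by rwa [uIcc_of_le hT.le]))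
    · exact h3.mono_set (uIcc_subset_uIcc_left (by rwa [uIcc_of_le hT.le]))
  have hAmono : ∀ s ∈ Icc 0 T, ∀ t ∈ Icc 0 T, s ≤ t → |A t ω - A s ω| = A t ω - A s ω := by
    intro s hs t ht hst
    refine abs_of_nonneg ?_
    rw [hAsub s hs t ht]
    exact intervalIntegral.integral_nonneg hst fun r _ => hg0 _
  set S : Set ℝ := {t | t ∈ Icc 0 T ∧ ∀ s ∈ D, |f (x t ω) - f (x s ω)| ≤ |A t ω - A s ω|} with hS
  have hDS : D ⊆ S := fun t ht => ⟨ht.1, fun s hs => h1 s hs t ht⟩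
  have hSae : ∀ᵐ t, t ∈ Icc 0 T → t ∈ S := by
    refine (ae_restrict_iff' measurableSet_Icc).1 ?_
    filter_upwards [(ae_ball_iff hDc).2 h2, ae_restrict_mem measurableSet_Icc] with t h h'
    exact ⟨h', h⟩
  have hSS : ∀ t ∈ S, ∀ t' ∈ S, t ≤ t' →
      |f (x t' ω) - f (x t ω)| ≤ ∫ r in t..t', g (x r ω) := by
    intro t ht t' ht' hle
    rcases hle.eq_or_lt with rfl | hlt
    · simp
    obtain ⟨q, hq1, hq2⟩ := exists_rat_btwn hlt
    have hqT : (q : ℝ) ∈ Icc 0 T := ⟨ht.1.1.trans hq1.le, hq2.le.trans ht'.1.2⟩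
    have hqD : (q : ℝ) ∈ D := ⟨hqT, Or.inr (Or.inr ⟨q, rfl⟩)⟩
    have e1 := ht.2 q hqD
    have e2 := ht'.2 q hqD
    rw [hAmono q hqT t' ht'.1 hq2.le] at e2
    rw [abs_sub_comm, abs_sub_comm (A t ω), hAmono t ht.1 q hqT hq1.le] at e1
    rw [← hAsub t ht.1 t' ht'.1]
    calc |f (x t' ω) - f (x t ω)|
        ≤ |f (x t' ω) - f (x q ω)| + |f (x q ω) - f (x t ω)| := abs_sub_le _ _ _
      _ ≤ A t' ω - A t ω := by linarith
  obtain ⟨U, hU, hUS, hUb⟩ := exists_absolutelyContinuous_extension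
    (u := fun t => f (x t ω)) (fun t ht => ht.1) hT.le h3 (fun r => hg0 _) hSS
  refine ⟨U, hU, hUS (hDS ⟨⟨le_rfl, hT.le⟩, Or.inl rfl⟩),
    hUS (hDS ⟨⟨hT.le, le_rfl⟩, Or.inr (Or.inl rfl)⟩), ?_, ae_abs_deriv_le hT.le h3 hUb hU⟩
  filter_upwards [hSae] with t h ht using hUS (h ht)

end MassTransport

/-! ### Conservation of mass and finite speed along curves -/

namespace MassTransport

universe u

variable {X : Type u} [MetricSpace X] [MeasurableSpace X] {μ ν η : Measure X}
  {θ : ℝ → ℝ} {νs ηs : ℕ → Measure X} {ε δ : ℝ}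

theorem ofReal_abs_toReal_sub {a b : ℝ≥0∞} (ha : a ≠ ⊤) (hb : b ≠ ⊤) :
    a - b ≤ ENNReal.ofReal |a.toReal - b.toReal| := by
  refine le_trans (le_of_eq ?_) (ENNReal.ofReal_le_ofReal (le_abs_self _))
  rw [ENNReal.ofReal_sub _ ENNReal.toReal_nonneg, ENNReal.ofReal_toReal ha,
    ENNReal.ofReal_toReal hb]

/-- The left side is the mass of a piece of mass `a` that stays uncoupled when its product with a
piece of mass `b` is divided by `max a b`. -/
theorem one_sub_div_max_mul_le {a b : ℝ≥0∞} (ha : a ≠ ⊤) (hb : b ≠ ⊤) :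
    (1 - (max a b)⁻¹ * b) * a ≤ a - b := by
  rcases le_or_gt a b with hab | hab
  · rcases eq_or_ne b 0 with rfl | hb0
    · simp [nonpos_iff_eq_zero.1 hab]
    · rw [max_eq_right hab, ENNReal.inv_mul_cancel hb0 hb]
      simp
  · have ha0 : a ≠ 0 := (bot_le.trans_lt hab).ne'
    rw [max_eq_left hab.le, ENNReal.sub_mul fun _ _ => ha, one_mul, mul_right_comm,
      ENNReal.inv_mul_cancel ha0 ha, one_mul]

theorem inv_max_mul_le_one {a b : ℝ≥0∞} : (max a b)⁻¹ * b ≤ 1 :=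
  (mul_le_mul_right (le_max_right a b) _).trans (ENNReal.inv_mul_le_one _)

theorem IsDecomposition.dist_le (h : IsDecomposition μ ε δ ν η νs ηs) (i : ℕ) {y z : X}
    (hy : y ∈ (νs i).support) (hz : z ∈ (ηs i).support) : dist y z ≤ ε :=
  (Metric.dist_le_diam_of_mem ((h.left_mem i).2.union (h.right_mem i).2).isBounded
    (Or.inl hy) (Or.inr hz)).trans (h.diam_le i)

theorem zero_mem_massM : (0 : Measure X) ∈ massM μ :=
  ⟨Measure.zero_le _, by simp⟩

/-- Measures at distance less than `ε` have a decomposition of scale `ε`. -/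
theorem exists_isDecomposition_of_massDist_lt (hθ : IsMassGauge θ) (hν : ν ∈ massM μ)
    (hη : η ∈ massM μ) (h : massDist θ μ ν η < ε) :
    ∃ νs ηs, IsDecomposition μ ε (θ ε) ν η νs ηs := by
  -- The real infimum of an empty set is `0`, so smallness of `massDist` says nothing without an
  -- admissible scale. A decomposition into one piece is admissible at a large scale since `θ` tends
  -- to infinity.
  have hne : {ε : ℝ | 0 < ε ∧ ∃ νs ηs : ℕ → Measure X,
      IsDecomposition μ ε (θ ε) ν η νs ηs}.Nonempty := by
    obtain ⟨E, hE1, hE2, hE3⟩ := ((hθ.tendsto_atTop.eventually_ge_atTop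
      |ν.real univ - η.real univ|).and ((eventually_gt_atTop 0).and
        (eventually_ge_atTop (Metric.diam (ν.support ∪ η.support))))).exists
    have hsum : ∀ ρ : Measure X, ρ = Measure.sum fun i : ℕ => if i = 0 then ρ else 0 := by
      intro ρ
      ext s hs
      rw [Measure.sum_apply _ hs, tsum_eq_single 0 (fun i hi => by simp [hi])]
      simp
    have hmem : ∀ ρ ∈ massM μ, ∀ i : ℕ, (if i = 0 then ρ else 0) ∈ massM μ := by
      intro ρ hρ i
      split_ifs
      · exact hρ
      · exact zero_mem_massM
    refine ⟨E, hE2, fun i => if i = 0 then ν else 0, fun i => if i = 0 then η else 0, hmem ν hν,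
      hmem η hη, hsum ν, hsum η, ?_, fun i => ?_⟩
    · rw [tsum_eq_single 0 (fun i hi => by simp [hi])]
      simpa using ENNReal.ofReal_le_ofReal hE1
    · rcases eq_or_ne i 0 with rfl | hi
      · simpa using hE3
      · simpa [hi] using hE2.le
  obtain ⟨ε', ⟨hε', νs, ηs, hd⟩, hlt⟩ := exists_lt_of_csInf_lt hne h
  exact ⟨νs, ηs, hd.left_mem, hd.right_mem, hd.left_sum, hd.right_sum,
    hd.mass_le.trans (ENNReal.ofReal_le_ofReal
      (hθ.strictMonoOn.monotoneOn hε'.le (hε'.trans hlt).le hlt.le)),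
    fun i => (hd.diam_le i).trans hlt.le⟩

variable {b : ℝ} {γ : ℝ → massX μ}

theorem IsCurve.exists_isDecomposition (hγ : IsCurve θ μ b γ) (hθ : IsMassGauge θ) {s t : ℝ}
    (hs : s ∈ Icc 0 b) (ht : t ∈ Icc 0 b) (h : |s - t| < ε) :
    ∃ νs ηs, IsDecomposition μ ε (θ ε) (γ s : Measure X) (γ t) νs ηs :=
  exists_isDecomposition_of_massDist_lt hθ (γ s).2.1 (γ t).2.1 ((hγ.2 s hs t ht).trans_lt h)

variable [SecondCountableTopology X]

theorem isFiniteMeasure_of_mem_massM [OpensMeasurableSpace X] [IsFiniteMeasureOnCompacts μ]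
    (hν : ν ∈ massM μ) :
    IsFiniteMeasure ν := by
  refine ⟨lt_of_le_of_lt (measure_mono_ae ?_) ((hν.1 ν.support).trans_lt hν.2.measure_lt_top)⟩
  filter_upwards [Measure.support_mem_ae (μ := ν)] with z hz _ using hz

variable [BorelSpace X]

/-- A decomposition of two measures with the same mass defines a coupling of them which moves
most of the mass by at most `ε`. -/
theorem IsDecomposition.exists_coupling [IsFiniteMeasure ν] [IsFiniteMeasure η]
    (hmass : ν univ = η univ) (h : IsDecomposition μ ε δ ν η νs ηs) :
    ∃ π : Measure (X × X), π.fst = ν ∧ π.snd = η ∧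
      π {p | ε < dist p.1 p.2} ≤ ENNReal.ofReal δ := by
  have hνs : ∀ i, νs i ≤ ν := fun i => h.left_sum ▸ Measure.le_sum νs i
  have hηs : ∀ i, ηs i ≤ η := fun i => h.right_sum ▸ Measure.le_sum ηs i
  have hνf : ∀ i, IsFiniteMeasure (νs i) := fun i => isFiniteMeasure_of_le ν (hνs i)
  have hηf : ∀ i, IsFiniteMeasure (ηs i) := fun i => isFiniteMeasure_of_le η (hηs i)
  set a : ℕ → ℝ≥0∞ := fun i => νs i univ with ha
  set b : ℕ → ℝ≥0∞ := fun i => ηs i univ with hb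
  have hat : ∀ i, a i ≠ ⊤ := fun i => measure_ne_top _ _
  have hbt : ∀ i, b i ≠ ⊤ := fun i => measure_ne_top _ _
  -- Dividing by the larger mass keeps the marginals of each term below `νs i` and `ηs i`. The
  -- remainders `ν'` and `η'` have equal mass, at most the total mass defect, and are coupled by a
  -- normalised product.
  set π₀ : Measure (X × X) :=
    Measure.sum fun i => (max (a i) (b i))⁻¹ • (νs i).prod (ηs i) with hπ₀
  set ν' : Measure X := Measure.sum fun i => (1 - (max (a i) (b i))⁻¹ * b i) • νs i with hν'
  set η' : Measure X := Measure.sum fun i => (1 - (max (b i) (a i))⁻¹ * a i) • ηs i with hη'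
  have hfst : π₀.fst + ν' = ν := by
    rw [hπ₀, Measure.fst_sum, hν', Measure.sum_add_sum]
    conv_rhs => rw [h.left_sum]
    congr 1
    funext i
    rw [Measure.fst, Measure.map_smul, Measure.map_fst_prod, smul_smul, ← add_smul,
      add_tsub_cancel_of_le inv_max_mul_le_one, one_smul]
  have hsnd : π₀.snd + η' = η := by
    rw [hπ₀, Measure.snd_sum, hη', Measure.sum_add_sum]
    conv_rhs => rw [h.right_sum]
    congr 1
    funext i
    rw [Measure.snd, Measure.map_smul, Measure.map_snd_prod, smul_smul, ← add_smul,
      max_comm (b i), add_tsub_cancel_of_le (by rw [max_comm]; exact inv_max_mul_le_one), one_smul]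
  have hν'f : IsFiniteMeasure ν' := isFiniteMeasure_of_le ν (hfst ▸ Measure.le_add_left le_rfl)
  have hη'f : IsFiniteMeasure η' := isFiniteMeasure_of_le η (hsnd ▸ Measure.le_add_left le_rfl)
  have hfstf : IsFiniteMeasure π₀.fst :=
    isFiniteMeasure_of_le ν (hfst ▸ Measure.le_add_right le_rfl)
  have hr : η' univ = ν' univ := by
    have h1 := congr($hfst univ)
    have h2 := congr($hsnd univ)
    rw [Measure.add_apply, Measure.fst_univ] at h1
    rw [Measure.add_apply, Measure.snd_univ, ← hmass, ← h1] at h2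
    refine (ENNReal.add_right_inj ?_).1 h2
    rw [← Measure.fst_univ]
    exact measure_ne_top _ _
  set r := ν' univ with hrdef
  have hrle : r ≤ ENNReal.ofReal δ := by
    refine le_trans ?_ h.mass_le
    rw [hrdef, hν', Measure.sum_apply _ MeasurableSet.univ]
    refine ENNReal.tsum_le_tsum fun i => ?_
    exact (one_sub_div_max_mul_le (hat i) (hbt i)).trans (ofReal_abs_toReal_sub (hat i) (hbt i))
  have hbad : π₀ {p | ε < dist p.1 p.2} = 0 := by
    rw [hπ₀, Measure.sum_apply _ (measurableSet_lt measurable_const measurable_dist),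
      ENNReal.tsum_eq_zero]
    intro i
    rw [Measure.smul_apply, smul_eq_mul]
    have hnull : ∀ᵐ p ∂((νs i).prod (ηs i)), ¬ ε < dist p.1 p.2 := by
      filter_upwards [Measure.quasiMeasurePreserving_fst.ae (Measure.support_mem_ae (μ := νs i)),
        Measure.quasiMeasurePreserving_snd.ae (Measure.support_mem_ae (μ := ηs i))] with p h1 h2
      exact not_lt.2 (h.dist_le i h1 h2)
    rw [ae_iff] at hnull
    simp only [not_not] at hnull
    rw [hnull, mul_zero]
  -- If `r = 0` the factor is `0`, but then `ρ` vanishes as well.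
  have hr1 : ∀ {ρ : Measure X}, ρ univ = r → (r⁻¹ * r) • ρ = ρ := fun {ρ} hρ => by
    rcases eq_or_ne r 0 with h0 | h0
    · rw [h0, Measure.measure_univ_eq_zero] at hρ
      simp [hρ]
    · rw [ENNReal.inv_mul_cancel h0 (measure_ne_top _ _), one_smul]
  refine ⟨π₀ + r⁻¹ • ν'.prod η', ?_, ?_, ?_⟩
  · rw [Measure.fst_add, Measure.fst, Measure.fst, Measure.map_smul, ← Measure.fst,
      Measure.map_fst_prod, hr, smul_smul, hr1 rfl, hfst]
  · rw [Measure.snd_add, Measure.snd, Measure.snd, Measure.map_smul, ← Measure.snd,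
      Measure.map_snd_prod, smul_smul, hr1 hr, hsnd]
  · rw [Measure.add_apply, hbad, zero_add, Measure.smul_apply, smul_eq_mul]
    refine le_trans ?_ hrle
    calc r⁻¹ * (ν'.prod η') {p | ε < dist p.1 p.2} ≤ r⁻¹ * (ν'.prod η') univ := by
          gcongr
          exact subset_univ _
      _ = r⁻¹ * r * r := by rw [← univ_prod_univ, Measure.prod_prod, hr, mul_assoc]
      _ ≤ 1 * r := by
          gcongr
          exact ENNReal.inv_mul_le_one _
      _ = r := one_mul r

/-- If a piece of `ν` charges `A`, its support meets `A`, and the whole matching piece of `η` lies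
within `ε` of `A`. Only the mass defects are lost. -/
theorem IsDecomposition.measure_le (h : IsDecomposition μ ε δ ν η νs ηs) [IsFiniteMeasure ν]
    [IsFiniteMeasure η] {A : Set X} (hA : MeasurableSet A) :
    ν A ≤ η (Metric.cthickening ε A) + ENNReal.ofReal δ := by
  have hνs : ∀ i, νs i ≤ ν := fun i => h.left_sum ▸ Measure.le_sum νs i
  have hηs : ∀ i, ηs i ≤ η := fun i => h.right_sum ▸ Measure.le_sum ηs i
  have hνf : ∀ i, IsFiniteMeasure (νs i) := fun i => isFiniteMeasure_of_le ν (hνs i)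
  have hηf : ∀ i, IsFiniteMeasure (ηs i) := fun i => isFiniteMeasure_of_le η (hηs i)
  refine le_trans ?_ (add_le_add_right h.mass_le _)
  conv_lhs => rw [h.left_sum]
  conv_rhs => rw [h.right_sum]
  rw [Measure.sum_apply _ hA,
    Measure.sum_apply _ (Metric.isClosed_cthickening (δ := ε) (E := A)).measurableSet,
    ← ENNReal.tsum_add]
  refine ENNReal.tsum_le_tsum fun i => ?_
  rcases eq_or_ne (νs i A) 0 with h0 | h0
  · simp [h0]
  obtain ⟨y, hyA, hy⟩ := Measure.nonempty_inter_support_of_pos (pos_iff_ne_zero.2 h0)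
  have hsub : (ηs i).support ⊆ Metric.cthickening ε A := fun z hz =>
    Metric.mem_cthickening_of_dist_le z y ε A hyA (by rw [dist_comm]; exact h.dist_le i hy hz)
  have hfull : ηs i (Metric.cthickening ε A) = ηs i univ := by
    refine le_antisymm (measure_mono (subset_univ _)) (measure_mono_ae ?_)
    filter_upwards [Measure.support_mem_ae (μ := ηs i)] with z hz _ using hsub hz
  rw [hfull]
  calc νs i A ≤ νs i univ := measure_mono (subset_univ _)
    _ ≤ ηs i univ + (νs i univ - ηs i univ) := le_add_tsub
    _ ≤ _ := add_le_add_right (ofReal_abs_toReal_sub (measure_ne_top _ _) (measure_ne_top _ _)) _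

theorem IsMassGauge.tendsto_mul_div (hθ : IsMassGauge θ) {C : ℝ} (hC : 0 < C) :
    Tendsto (fun n : ℕ => (n : ℝ) * θ (C / n)) atTop (𝓝 0) := by
  have h1 : Tendsto (fun n : ℕ => C / (n : ℝ)) atTop (𝓝[>] 0) := by
    refine tendsto_nhdsWithin_iff.2 ⟨tendsto_const_div_atTop_nhds_zero_nat C, ?_⟩
    filter_upwards [eventually_gt_atTop 0] with n hn
    exact div_pos hC (Nat.cast_pos.2 hn)
  have h2 := (hθ.tendsto_div.comp h1).const_mul C
  rw [mul_zero] at h2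
  refine h2.congr' ?_
  filter_upwards [eventually_gt_atTop 0] with n hn
  have : (n : ℝ) ≠ 0 := (Nat.cast_pos.2 hn).ne'
  simp only [Function.comp_apply]
  field_simp

variable [IsFiniteMeasureOnCompacts μ]

/-- No mass is lost along a curve, and mass moves with speed at most `1`. -/
theorem IsCurve.measure_le (hγ : IsCurve θ μ b γ) (hθ : IsMassGauge θ) {s t : ℝ}
    (hs : s ∈ Icc 0 b) (ht : t ∈ Icc 0 b) (h : |s - t| < ε) {A : Set X} (hA : IsClosed A) :
    (γ t : Measure X) A ≤ (γ s : Measure X) (Metric.cthickening ε A) := by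
  have hε : 0 < ε := (abs_nonneg _).trans_lt h
  have hfin : ∀ r, IsFiniteMeasure (γ r : Measure X) := fun r =>
    isFiniteMeasure_of_mem_massM (γ r).2.1
  have key : ∀ n : ℕ, 0 < n → (γ t : Measure X) A ≤
      (γ s : Measure X) (Metric.cthickening ε A) + ENNReal.ofReal (n * θ (ε / n)) := by
    intro n hn
    have hn' : (0 : ℝ) < n := Nat.cast_pos.2 hn
    have hθn : 0 ≤ θ (ε / n) := by
      rw [← hθ.map_zero]
      exact hθ.strictMonoOn.monotoneOn (mem_Ici.2 le_rfl) (mem_Ici.2 (by positivity)) (by positivity)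
    -- Each of the `n` equal steps is strictly shorter than `ε / n`, as `massDist < ε / n` is needed
    -- for a decomposition. The thickenings add up to `ε` and the defects to `n θ(ε / n)`, which
    -- vanishes in the limit.
    set τ : ℕ → ℝ := fun k => t + (k / n : ℝ) * (s - t) with hτ
    have hτmem : ∀ k ≤ n, τ k ∈ Icc 0 b := fun k hk =>
      (convex_Icc 0 b).add_smul_sub_mem ht hs
        ⟨by positivity, (div_le_one hn').2 (Nat.cast_le.2 hk)⟩
    have hstep : ∀ k ≤ n, (γ t : Measure X) A ≤
        (γ (τ k) : Measure X) (Metric.cthickening (k * (ε / n)) A) +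
          ENNReal.ofReal (k * θ (ε / n)) := by
      intro k
      induction k with
      | zero => simp [hτ]
      | succ k ih =>
        intro hk
        have hdist : |τ k - τ (k + 1)| < ε / n := by
          have : τ k - τ (k + 1) = -((s - t) / n) := by
            simp only [hτ]
            push_cast
            field_simp
            ring
          rw [this, abs_neg, abs_div, abs_of_pos hn']
          gcongr
        obtain ⟨νs, ηs, hd⟩ := hγ.exists_isDecomposition hθ (hτmem k (by omega))
          (hτmem (k + 1) hk) hdist
        refine (ih (by omega)).trans ?_
        refine (add_le_add_left (hd.measure_le
          (Metric.isClosed_cthickening (δ := k * (ε / n)) (E := A)).measurableSet) _).trans ?_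
        rw [add_assoc, ← ENNReal.ofReal_add hθn (by positivity)]
        refine add_le_add (measure_mono ((Metric.cthickening_cthickening_subset (by positivity)
          (by positivity) A).trans (Metric.cthickening_mono (le_of_eq ?_) A))) (le_of_eq ?_)
        · push_cast
          ring
        · congr 1
          push_cast
          ring
    have h1 := hstep n le_rfl
    have h2 : τ n = s := by
      simp only [hτ, div_self hn'.ne']
      ring
    rwa [h2, mul_div_cancel₀ _ hn'.ne'] at h1
  have hlim : Tendsto (fun n : ℕ => (γ s : Measure X) (Metric.cthickening ε A) +
      ENNReal.ofReal (n * θ (ε / n))) atTop (𝓝 ((γ s : Measure X) (Metric.cthickening ε A))) := by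
    have := (ENNReal.tendsto_ofReal (hθ.tendsto_mul_div hε)).const_add
      ((γ s : Measure X) (Metric.cthickening ε A))
    simpa using this
  refine ge_of_tendsto hlim ?_
  filter_upwards [eventually_gt_atTop 0] with n hn using key n hn

theorem IsCurve.measure_univ_eq (hγ : IsCurve θ μ b γ) (hθ : IsMassGauge θ) {s t : ℝ}
    (hs : s ∈ Icc 0 b) (ht : t ∈ Icc 0 b) : (γ s : Measure X) univ = (γ t : Measure X) univ := by
  have main : ∀ s ∈ Icc 0 b, ∀ t ∈ Icc 0 b, (γ t : Measure X) univ ≤ (γ s : Measure X) univ :=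
    fun s hs t ht => (hγ.measure_le hθ hs ht (lt_add_one _) isClosed_univ).trans
      (measure_mono (subset_univ _))
  exact le_antisymm (main t ht s hs) (main s hs t ht)

/-- Finite speed applied to the complement of the open `ρ`-thickening of the initial support: its
closed `r`-thickening with `t < r < ρ` still misses that support. -/
theorem IsCurve.ae_mem_cthickening (hγ : IsCurve θ μ b γ) (hθ : IsMassGauge θ) {ρ t : ℝ}
    (ht : t ∈ Icc 0 b) (htρ : t < ρ) :
    ∀ᵐ y ∂(γ t : Measure X), y ∈ Metric.cthickening ρ (γ 0 : Measure X).support := by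
  have h0 : (0 : ℝ) ∈ Icc 0 b := ⟨le_rfl, hγ.1⟩
  obtain ⟨r, htr, hrρ⟩ := exists_between htρ
  set S := (γ 0 : Measure X).support with hS
  set A := (Metric.thickening ρ S)ᶜ with hA
  have hAc : IsClosed A := Metric.isOpen_thickening.isClosed_compl
  have h1 := hγ.measure_le (ε := r) hθ h0 ht (by rwa [zero_sub, abs_neg, abs_of_nonneg ht.1]) hAc
  have h2 : Metric.cthickening r A ⊆ Sᶜ := by
    intro z hz hzS
    obtain ⟨w, hw, hzw⟩ := Metric.mem_thickening_iff.1
      (Metric.cthickening_subset_thickening' (ht.1.trans_lt htρ) hrρ A hz)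
    exact hw (Metric.mem_thickening_iff.2 ⟨z, hzS, by rwa [dist_comm]⟩)
  have h3 : (γ t : Measure X) A = 0 := le_antisymm
    (h1.trans ((measure_mono h2).trans (le_of_eq Measure.measure_compl_support))) bot_le
  rw [ae_iff]
  exact measure_mono_null (fun y hy hy' => hy (Metric.thickening_subset_cthickening ρ S hy')) h3

end MassTransport

/-! ### Gluing couplings, and transports of speed at most one -/

namespace MassTransport

open ProbabilityTheory

universe u

section Chain

variable {Y : Type u} [MeasurableSpace Y]

/-- Couplings of consecutive terms of a sequence of probability measures glue to a measure
on sequences. -/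
theorem exists_chain [StandardBorelSpace Y] [Nonempty Y] (ρ : ℕ → Measure Y)
    [∀ k, IsProbabilityMeasure (ρ k)] (π : ℕ → Measure (Y × Y)) (hfst : ∀ k, (π k).fst = ρ k)
    (hsnd : ∀ k, (π k).snd = ρ (k + 1)) (N : ℕ) :
    ∃ P : Measure (ℕ → Y), IsProbabilityMeasure P ∧ (∀ k ≤ N, P.map (fun x => x k) = ρ k) ∧
      ∀ k < N, P.map (fun x => (x k, x (k + 1))) = π k := by
  induction N with
  | zero =>
    refine ⟨(ρ 0).map fun y _ => y, ?_, fun k hk => ?_, fun k hk => absurd hk (by omega)⟩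
    · exact Measure.isProbabilityMeasure_map (by fun_prop)
    · rw [Measure.map_map (by fun_prop) (by fun_prop), nonpos_iff_eq_zero.1 hk]
      exact Measure.map_id
  | succ N ih =>
    obtain ⟨P, hP, hmarg, hpair⟩ := ih
    have hπ : ∀ k, IsProbabilityMeasure (π k) := fun k => ⟨by
      rw [← Measure.fst_univ, hfst, measure_univ]⟩
    -- A Markov step: the next point is drawn from `π N` conditioned on its first coordinate being
    -- the current point `x N`.
    set κ : Kernel (ℕ → Y) Y := (π N).condKernel.comap (fun x => x N) (measurable_pi_apply N)
      with hκ
    set Q : Measure ((ℕ → Y) × Y) := P ⊗ₘ κ with hQ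
    have hQfst : Q.fst = P := Measure.fst_compProd P κ
    have hQpair : Q.map (fun p => (p.1 N, p.2)) = π N := by
      conv_rhs => rw [← (π N).disintegrate (π N).condKernel, hfst, ← hmarg N le_rfl]
      have hm : Measurable fun p : (ℕ → Y) × Y => (p.1 N, p.2) := by fun_prop
      ext s hs
      rw [Measure.map_apply hm hs, hQ, Measure.compProd_apply (hm hs), Measure.compProd_apply hs,
        lintegral_map (Kernel.measurable_kernel_prodMk_left hs) (measurable_pi_apply N)]
      rfl
    set u : (ℕ → Y) × Y → ℕ → Y := fun p => Function.update p.1 (N + 1) p.2 with hu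
    have hum : Measurable u := by
      refine measurable_pi_iff.2 fun k => ?_
      rcases eq_or_ne k (N + 1) with rfl | hk
      · simp only [hu, Function.update_self]
        exact measurable_snd
      · simp only [hu, Function.update_of_ne hk]
        fun_prop
    have hold : ∀ k ≤ N, ∀ p, u p k = p.1 k := fun k hk p => by
      simp only [hu]
      exact Function.update_of_ne (by omega) _ _
    have hnew : ∀ p, u p (N + 1) = p.2 := fun p => by simp [hu]
    refine ⟨Q.map u, Measure.isProbabilityMeasure_map hum.aemeasurable, fun k hk => ?_,
      fun k hk => ?_⟩
    · rw [Measure.map_map (measurable_pi_apply k) hum]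
      rcases Nat.le_succ_iff.1 hk with hk | rfl
      · have : (fun x : ℕ → Y => x k) ∘ u = (fun x => x k) ∘ Prod.fst := funext (hold k hk)
        rw [this, ← Measure.map_map (measurable_pi_apply k) measurable_fst, ← Measure.fst, hQfst,
          hmarg k hk]
      · have : (fun x : ℕ → Y => x (N + 1)) ∘ u =
            Prod.snd ∘ fun p : (ℕ → Y) × Y => (p.1 N, p.2) := funext hnew
        rw [this, ← Measure.map_map measurable_snd (by fun_prop), hQpair, ← Measure.snd, hsnd]
    · rw [Measure.map_map (by fun_prop) hum]
      rcases Nat.lt_succ_iff_lt_or_eq.1 hk with hk | rfl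
      · have : (fun x : ℕ → Y => (x k, x (k + 1))) ∘ u = (fun x => (x k, x (k + 1))) ∘ Prod.fst :=
          funext fun p => by simp only [Function.comp_apply, hold k hk.le, hold (k + 1) hk]
        rw [this, ← Measure.map_map (by fun_prop) measurable_fst, ← Measure.fst, hQfst,
          hpair k hk]
      · have : (fun x : ℕ → Y => (x k, x (k + 1))) ∘ u = fun p : (ℕ → Y) × Y => (p.1 k, p.2) :=
          funext fun p => by simp only [Function.comp_apply, hold k le_rfl, hnew]
        rw [this, hQpair]

end Chain

theorem integral_le_add_of_measure_le {Z : Type*} [MeasurableSpace Z] {P : Measure Z}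
    [IsProbabilityMeasure P] {F : Z → ℝ} {B : Set Z} {c D β : ℝ} (hF : Integrable F P)
    (hD : 0 ≤ D) (hβ : 0 ≤ β) (hc : 0 ≤ c)
    (hgood : ∀ z, z ∉ B → F z ≤ c) (hbad : ∀ z, F z ≤ D) (hB : P B ≤ ENNReal.ofReal β) :
    ∫ z, F z ∂P ≤ c + D * β := by
  have hBm := measurableSet_toMeasurable P B
  have h1 : ∫ z, F z ∂P ≤ ∫ z, c + (toMeasurable P B).indicator (fun _ => D) z ∂P := by
    refine integral_mono hF ((integrable_const c).add ((integrable_const D).indicator hBm))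
      fun z => ?_
    by_cases hz : z ∈ toMeasurable P B
    · simp only [indicator_of_mem hz]
      linarith [hbad z]
    · simp only [indicator_of_notMem hz, add_zero]
      exact hgood z fun h => hz (subset_toMeasurable P B h)
  refine h1.trans ?_
  rw [integral_add (integrable_const c) ((integrable_const D).indicator hBm),
    integral_indicator_const D hBm, integral_const, probReal_univ, one_smul, smul_eq_mul,
    mul_comm D]
  gcongr
  rw [measureReal_def, measure_toMeasurable]
  exact ENNReal.toReal_le_of_le_ofReal hβ hB

section Path

variable {Y : Type u} [MetricSpace Y] [CompactSpace Y] [MeasurableSpace Y] [BorelSpace Y]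
  {ν : ℝ → Measure Y} {β : ℝ → ℝ}

/-- `ν` moves with speed at most `1`, up to a small portion of the mass, controlled by `β`. -/
def IsApproxTransport (ν : ℝ → Measure Y) (β : ℝ → ℝ) : Prop :=
  ∀ s t ε, |s - t| < ε → ∃ π : Measure (Y × Y), π.fst = ν s ∧ π.snd = ν t ∧
    π {p | ε < dist p.1 p.2} ≤ ENNReal.ofReal (β ε)

theorem integrable_continuous_of_compactSpace {Z : Type*} [TopologicalSpace Z] [CompactSpace Z]
    [MeasurableSpace Z] [OpensMeasurableSpace Z] {P : Measure Z} [IsFiniteMeasure P]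
    {φ : Z → ℝ} (hφ : Continuous φ) : Integrable φ P :=
  hφ.integrable_of_hasCompactSupport (HasCompactSupport.of_compactSpace φ)

/-- Under the coupling of `ν s` and `ν t`, the increment of `φ` is small by uniform continuity,
except on a set of mass at most `β ε`, where it is at most twice the sup norm. -/
theorem IsApproxTransport.continuous_integral [∀ t, IsProbabilityMeasure (ν t)]
    (h : IsApproxTransport ν β) (hβ0 : ∀ ε, 0 ≤ ε → 0 ≤ β ε) (hβ : Tendsto β (𝓝[>] 0) (𝓝 0))
    {φ : Y → ℝ} (hφ : Continuous φ) : Continuous fun t => ∫ y, φ y ∂(ν t) := by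
  obtain ⟨C, hC⟩ := isCompact_univ.exists_bound_of_continuousOn (f := φ) hφ.continuousOn
  have hC0 : 0 ≤ max C 0 := le_max_right _ _
  have hC' : ∀ y, |φ y| ≤ max C 0 := fun y => (hC y (mem_univ y)).trans (le_max_left _ _)
  have key : ∀ s t ε c, |s - t| < ε → 0 ≤ c → (∀ y z, dist y z ≤ ε → |φ y - φ z| ≤ c) →
      ∫ y, φ y ∂(ν s) - ∫ y, φ y ∂(ν t) ≤ c + (2 * max C 0) * β ε := by
    intro s t ε c hst hc hyz
    obtain ⟨π, h1, h2, h3⟩ := h s t ε hst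
    have hπ : IsProbabilityMeasure π := ⟨by rw [← Measure.fst_univ, h1, measure_univ]⟩
    have i1 : Integrable (fun p : Y × Y => φ p.1) π :=
      integrable_continuous_of_compactSpace (by fun_prop)
    have i2 : Integrable (fun p : Y × Y => φ p.2) π :=
      integrable_continuous_of_compactSpace (by fun_prop)
    rw [← h1, ← h2, Measure.fst, Measure.snd,
      integral_map measurable_fst.aemeasurable hφ.aestronglyMeasurable,
      integral_map measurable_snd.aemeasurable hφ.aestronglyMeasurable, ← integral_sub i1 i2]
    refine integral_le_add_of_measure_le (i1.sub i2) (by positivity)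
      (hβ0 ε ((abs_nonneg _).trans hst.le)) hc (fun p hp => ?_) (fun p => ?_) h3
    · exact (le_abs_self _).trans (hyz _ _ (not_lt.1 hp))
    · have e1 := abs_le.1 (hC' p.1)
      have e2 := abs_le.1 (hC' p.2)
      linarith
  refine Metric.continuous_iff.2 fun t δ hδ => ?_
  obtain ⟨r, hr, hφr⟩ := Metric.uniformContinuous_iff.1
    (CompactSpace.uniformContinuous_of_continuous hφ) (δ / 4) (by positivity)
  have hev : ∀ᶠ ε in 𝓝[>] (0 : ℝ), (2 * max C 0) * β ε < δ / 4 := by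
    have := hβ.const_mul (2 * max C 0)
    rw [mul_zero] at this
    exact this.eventually (gt_mem_nhds (by positivity))
  obtain ⟨ε, hε1, hε2⟩ := (hev.and (Ioo_mem_nhdsGT hr)).exists
  refine ⟨ε, hε2.1, fun s hs => ?_⟩
  have hφε : ∀ y z, dist y z ≤ ε → |φ y - φ z| ≤ δ / 4 := fun y z hyz =>
    (hφr (hyz.trans_lt hε2.2)).le
  rw [Real.dist_eq] at hs ⊢
  have a1 := key s t ε _ hs (by positivity) hφε
  have a2 := key t s ε _ (by rwa [abs_sub_comm]) (by positivity) hφε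
  rw [abs_lt]
  constructor <;> linarith

end Path

end MassTransport

/-! ### Compactness: from discrete chains to paths with rational times -/

namespace MassTransport

open ProbabilityTheory

universe u

variable {Y : Type u} [MetricSpace Y] [CompactSpace Y] [MeasurableSpace Y] [BorelSpace Y]
  {ν : ℝ → Measure Y} {β : ℝ → ℝ}

/-- Glue the couplings of consecutive times. A union bound over the `N` steps controls the chains
with a jump above `ε`; the others obey the bound by the triangle inequality. -/
theorem IsApproxTransport.exists_chain [Nonempty Y] [∀ t, IsProbabilityMeasure (ν t)]
    (h : IsApproxTransport ν β) {τ ε : ℝ} (hτ : 0 ≤ τ) (hτε : τ < ε)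
    (N : ℕ) :
    ∃ P : Measure (ℕ → Y), IsProbabilityMeasure P ∧
      (∀ k ≤ N, P.map (fun x => x k) = ν (k * τ)) ∧
      P {x | ¬ ∀ k ≤ N, ∀ l ≤ N, dist (x k) (x l) ≤ |(k : ℝ) - l| * ε} ≤
        ENNReal.ofReal (N * β ε) := by
  have hstep : ∀ k : ℕ, ∃ π : Measure (Y × Y), π.fst = ν (k * τ) ∧ π.snd = ν ((k + 1 : ℕ) * τ) ∧
      π {p | ε < dist p.1 p.2} ≤ ENNReal.ofReal (β ε) := fun k => by
    refine h _ _ ε ?_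
    have : (k : ℝ) * τ - (k + 1 : ℕ) * τ = -τ := by
      push_cast
      ring
    rwa [this, abs_neg, abs_of_nonneg hτ]
  choose π h1 h2 h3 using hstep
  obtain ⟨P, hP, hmarg, hpair⟩ := MassTransport.exists_chain (fun k => ν (k * τ)) π h1 h2 N
  refine ⟨P, hP, hmarg, ?_⟩
  have hε : 0 ≤ ε := hτ.trans hτε.le
  have hsub : {x : ℕ → Y | ¬ ∀ k ≤ N, ∀ l ≤ N, dist (x k) (x l) ≤ |(k : ℝ) - l| * ε} ⊆
      ⋃ k ∈ Finset.range N, (fun x : ℕ → Y => (x k, x (k + 1))) ⁻¹' {p | ε < dist p.1 p.2} := by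
    intro x hx
    by_contra hcon
    simp only [mem_iUnion, mem_preimage, mem_ofPred_eq, exists_prop, not_exists, not_and,
      Finset.mem_range, not_lt] at hcon
    refine hx ?_
    have main : ∀ k l, k ≤ l → l ≤ N → dist (x k) (x l) ≤ |(k : ℝ) - l| * ε := by
      intro k l hkl hl
      have := dist_le_Ico_sum_of_dist_le (f := x) (d := fun _ => ε) hkl
        fun {i} _ hi => hcon i (hi.trans_le hl)
      rw [Finset.sum_const, Nat.card_Ico, nsmul_eq_mul, Nat.cast_sub hkl] at this
      rwa [abs_sub_comm, abs_of_nonneg (sub_nonneg.2 (Nat.cast_le.2 hkl))]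
    intro k hk l hl
    rcases le_total k l with hkl | hkl
    · exact main k l hkl hl
    · rw [dist_comm, abs_sub_comm]
      exact main l k hkl hk
  refine (measure_mono hsub).trans ((measure_biUnion_finset_le _ _).trans ?_)
  have hm : MeasurableSet {p : Y × Y | ε < dist p.1 p.2} :=
    measurableSet_lt measurable_const measurable_dist
  calc ∑ k ∈ Finset.range N, P ((fun x : ℕ → Y => (x k, x (k + 1))) ⁻¹' {p | ε < dist p.1 p.2})
      ≤ ∑ k ∈ Finset.range N, ENNReal.ofReal (β ε) := by
        refine Finset.sum_le_sum fun k hk => ?_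
        rw [← Measure.map_apply (by fun_prop) hm, hpair k (Finset.mem_range.1 hk)]
        exact h3 k
    _ = ENNReal.ofReal (N * β ε) := by
        rw [Finset.sum_const, Finset.card_range, nsmul_eq_mul,
          ENNReal.ofReal_mul (Nat.cast_nonneg N), ENNReal.ofReal_natCast]

theorem tendsto_of_tendsto_div (hβ : Tendsto (fun ε => β ε / ε) (𝓝[>] 0) (𝓝 0)) :
    Tendsto β (𝓝[>] 0) (𝓝 0) := by
  have h1 : Tendsto (fun ε : ℝ => ε) (𝓝[>] 0) (𝓝 0) := tendsto_id.mono_left nhdsWithin_le_nhds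
  have h2 := hβ.mul h1
  rw [mul_zero] at h2
  refine h2.congr' ?_
  filter_upwards [self_mem_nhdsWithin] with ε hε
  exact div_mul_cancel₀ _ (ne_of_gt hε)

/-- A transport with speed at most `1` comes from a measure on `1`-Lipschitz paths. -/
theorem IsApproxTransport.exists_measure_rat_path [Nonempty Y] [∀ t, IsProbabilityMeasure (ν t)]
    (h : IsApproxTransport ν β) (hβ0 : ∀ ε, 0 ≤ ε → 0 ≤ β ε)
    (hβ : Tendsto (fun ε => β ε / ε) (𝓝[>] 0) (𝓝 0)) {T : ℝ} (hT : 0 ≤ T) :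
    ∃ Q : Measure (ℚ → Y), IsProbabilityMeasure Q ∧
      (∀ᵐ ω ∂Q, ∀ p q : ℚ, dist (ω p) (ω q) ≤ |(p : ℝ) - q|) ∧
      ∀ q : ℚ, Q.map (fun ω => ω q) = ν (max 0 (min T q)) := by
  set t : ℕ → ℝ := fun n => ((n : ℝ) + 1)⁻¹ with ht
  -- The coupling scale must strictly exceed the mesh `t n`, while `e n / t n → 1` keeps the
  -- limiting speed at `1`. Then `N n * β (e n)` is of order `β (e n) / e n` and tends to `0`.
  set e : ℕ → ℝ := fun n => t n + t n ^ 2 with he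
  have htpos : ∀ n, 0 < t n := fun n => by positivity
  have hte : ∀ n, t n < e n := fun n => lt_add_of_pos_right _ (pow_pos (htpos n) 2)
  have hepos : ∀ n, 0 < e n := fun n => (htpos n).trans (hte n)
  set c : ℚ → ℝ := fun q => max 0 (min T q) with hc
  have hc0 : ∀ q, 0 ≤ c q := fun q => le_max_left _ _
  have hcT : ∀ q, c q ≤ T := fun q => max_le hT (min_le_left _ _)
  have hcd : ∀ p q, |c p - c q| ≤ |(p : ℝ) - q| := fun p q => by
    refine (abs_max_sub_max_le_max 0 (min T p) 0 (min T q)).trans (max_le (by simp) ?_)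
    exact (abs_min_sub_min_le_max T p T q).trans (max_le (by simp) le_rfl)
  set k : ℕ → ℚ → ℕ := fun n q => ⌊c q * (n + 1)⌋₊ with hk
  set N : ℕ → ℕ := fun n => ⌊T * (n + 1)⌋₊ with hN
  have hkN : ∀ n q, k n q ≤ N n := fun n q => Nat.floor_mono (by
    gcongr
    exact hcT q)
  have hkle : ∀ n q, (k n q : ℝ) ≤ c q * (n + 1) := fun n q =>
    Nat.floor_le (mul_nonneg (hc0 q) (by positivity))
  have hklt : ∀ n q, c q * (n + 1) < k n q + 1 := fun n q => Nat.lt_floor_add_one _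
  choose P hP hmarg hbad using fun n => h.exists_chain (htpos n).le (hte n) (N n)
  have hrm : ∀ n, Measurable fun (x : ℕ → Y) (q : ℚ) => x (k n q) := fun n => by fun_prop
  set Q : ℕ → ProbabilityMeasure (ℚ → Y) := fun n =>
    ⟨(P n).map fun x q => x (k n q), Measure.isProbabilityMeasure_map (hrm n).aemeasurable⟩ with hQ
  -- Probability measures on the compact space `ℚ → Y` form a compact space; an ultrafilter limit
  -- replaces the choice of a subsequence.
  obtain ⟨R, -, hR⟩ := isCompact_univ.ultrafilter_le_nhds ((hyperfilter ℕ).map Q) (by simp)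
  have hR' : Tendsto Q (hyperfilter ℕ) (𝓝 R) := hR
  have hat : (hyperfilter ℕ : Filter ℕ) ≤ atTop := Nat.hyperfilter_le_atTop
  have hint : ∀ F : (ℚ → Y) → ℝ, Continuous F →
      Tendsto (fun n => ∫ x, F (fun q => x (k n q)) ∂(P n)) (hyperfilter ℕ)
        (𝓝 (∫ ω, F ω ∂(R : Measure (ℚ → Y)))) := by
    intro F hF
    have := ProbabilityMeasure.tendsto_iff_forall_integral_tendsto.1 hR'
      (BoundedContinuousFunction.mkOfCompact ⟨F, hF⟩)
    refine this.congr fun n => ?_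
    exact integral_map (hrm n).aemeasurable hF.aestronglyMeasurable
  have ht0 : Tendsto t atTop (𝓝 0) := by
    simpa only [ht, one_div] using tendsto_one_div_add_atTop_nhds_zero_nat (𝕜 := ℝ)
  have he0 : Tendsto e atTop (𝓝 0) := by simpa using ht0.add (ht0.pow 2)
  have he0' : Tendsto e atTop (𝓝[>] 0) :=
    tendsto_nhdsWithin_iff.2 ⟨he0, Eventually.of_forall hepos⟩
  have hte1 : ∀ n : ℕ, ((n : ℝ) + 1) * e n = 1 + t n := fun n => by
    simp only [he, ht]
    field_simp
  have hNβ : Tendsto (fun n => (N n : ℝ) * β (e n)) atTop (𝓝 0) := by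
    have hlim : Tendsto (fun n => T * ((1 + t n) * (β (e n) / e n))) atTop (𝓝 0) := by
      have := ((ht0.const_add 1).mul (hβ.comp he0')).const_mul T
      simpa using this
    refine squeeze_zero (fun n => mul_nonneg (Nat.cast_nonneg _) (hβ0 _ (hepos n).le))
      (fun n => ?_) hlim
    rw [← hte1, mul_assoc, mul_div_cancel₀ _ (hepos n).ne', ← mul_assoc]
    exact mul_le_mul_of_nonneg_right (Nat.floor_le (by positivity)) (hβ0 _ (hepos n).le)
  refine ⟨R, inferInstance, ?_, fun q => ?_⟩
  · refine ae_all_iff.2 fun p => ae_all_iff.2 fun q => ?_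
    -- A continuous penalty vanishing exactly where the Lipschitz bound holds at `p` and `q`. Its
    -- integral passes to the limit and is `0` there.
    set F : (ℚ → Y) → ℝ := fun ω => max 0 (dist (ω p) (ω q) - |(p : ℝ) - q|) with hF
    have hFc : Continuous F := by fun_prop
    set D := Metric.diam (univ : Set Y)
    have hle : ∀ n, ∫ x, F (fun q => x (k n q)) ∂(P n) ≤
        ((|(p : ℝ) - q| * (n + 1) + 1) * e n - |(p : ℝ) - q|) + D * (N n * β (e n)) := by
      intro n
      have hge : 0 ≤ (|(p : ℝ) - q| * (n + 1) + 1) * e n - |(p : ℝ) - q| := by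
        have e1 : (|(p : ℝ) - q| * (n + 1) + 1) * e n - |(p : ℝ) - q| =
            |(p : ℝ) - q| * (((n : ℝ) + 1) * e n - 1) + e n := by ring
        rw [e1, hte1, add_sub_cancel_left]
        have := htpos n
        have := hepos n
        positivity
      have hP' := hP n
      refine integral_le_add_of_measure_le (P := P n)
        (B := {x | ¬ ∀ k ≤ N n, ∀ l ≤ N n, dist (x k) (x l) ≤ |(k : ℝ) - l| * e n})
        (integrable_continuous_of_compactSpace (by fun_prop)) Metric.diam_nonneg
        (mul_nonneg (Nat.cast_nonneg _) (hβ0 _ (hepos n).le)) hge (fun x hx => ?_) (fun x => ?_)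
        (hbad n)
      · have hx' : ∀ k ≤ N n, ∀ l ≤ N n, dist (x k) (x l) ≤ |(k : ℝ) - l| * e n := not_not.1 hx
        refine max_le hge (sub_le_sub_right ((hx' _ (hkN n p) _ (hkN n q)).trans ?_) _)
        refine mul_le_mul_of_nonneg_right ?_ (hepos n).le
        have h1 : |c p * (n + 1) - c q * (n + 1)| ≤ |(p : ℝ) - q| * (n + 1) := by
          rw [← sub_mul, abs_mul, abs_of_pos (by positivity : (0 : ℝ) < n + 1)]
          exact mul_le_mul_of_nonneg_right (hcd p q) (by positivity)
        have h2 := hkle n p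
        have h3 := hkle n q
        have h4 := hklt n p
        have h5 := hklt n q
        rw [abs_le] at h1 ⊢
        constructor <;> linarith [h1.1, h1.2]
      · refine max_le Metric.diam_nonneg ((sub_le_self _ (abs_nonneg _)).trans ?_)
        exact Metric.dist_le_diam_of_mem isCompact_univ.isBounded (mem_univ _) (mem_univ _)
    have hlim : Tendsto (fun n : ℕ => ((|(p : ℝ) - q| * (n + 1) + 1) * e n - |(p : ℝ) - q|) +
        D * (N n * β (e n))) atTop (𝓝 0) := by
      have e1 : ∀ n : ℕ, (|(p : ℝ) - q| * (n + 1) + 1) * e n - |(p : ℝ) - q| =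
          |(p : ℝ) - q| * t n + e n := fun n => by
        have := hte1 n
        linear_combination |(p : ℝ) - q| * this
      simp only [e1]
      simpa using ((ht0.const_mul |(p : ℝ) - q|).add he0).add (hNβ.const_mul D)
    have h0 : ∫ ω, F ω ∂(R : Measure (ℚ → Y)) ≤ 0 :=
      le_of_tendsto_of_tendsto (hint F hFc) (hlim.mono_left hat) (Eventually.of_forall hle)
    have hF0 : ∀ ω, 0 ≤ F ω := fun ω => le_max_left _ _
    have h1 := (integral_eq_zero_iff_of_nonneg hF0 (integrable_continuous_of_compactSpace hFc)).1
      (le_antisymm h0 (integral_nonneg hF0))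
    filter_upwards [h1] with ω hω
    have : dist (ω p) (ω q) - |(p : ℝ) - q| ≤ F ω := le_max_right _ _
    rw [hω, Pi.zero_apply] at this
    linarith
  · have : IsProbabilityMeasure ((R : Measure (ℚ → Y)).map fun ω => ω q) :=
      Measure.isProbabilityMeasure_map (measurable_pi_apply q).aemeasurable
    refine ext_of_forall_integral_eq_of_IsFiniteMeasure fun φ => ?_
    rw [integral_map (measurable_pi_apply q).aemeasurable φ.continuous.aestronglyMeasurable]
    have hcont := h.continuous_integral hβ0 (tendsto_of_tendsto_div hβ) φ.continuous
    have hkt : Tendsto (fun n => (k n q : ℝ) * t n) atTop (𝓝 (c q)) := by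
      refine tendsto_order.2 ⟨fun a ha => ?_, fun a ha => Eventually.of_forall fun n => ?_⟩
      · filter_upwards [(ht0.const_sub (c q)).eventually (lt_mem_nhds (by simpa using ha))]
          with n hn
        refine hn.trans ?_
        have h1 := hklt n q
        have h2 : c q = c q * (n + 1) * t n := by
          simp only [ht]
          field_simp
        have h3 : c q * (n + 1) * t n < (k n q + 1) * t n :=
          mul_lt_mul_of_pos_right h1 (htpos n)
        linarith
      · refine lt_of_le_of_lt ?_ ha
        have h2 : c q = c q * (n + 1) * t n := by
          simp only [ht]
          field_simp
        rw [h2]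
        exact mul_le_mul_of_nonneg_right (hkle n q) (htpos n).le
    refine tendsto_nhds_unique (hint (fun ω => φ (ω q)) (by fun_prop)) ?_
    refine (((hcont.tendsto _).comp hkt).mono_left hat).congr fun n => ?_
    rw [Function.comp_apply, ← hmarg n _ (hkN n q),
      integral_map (measurable_pi_apply _).aemeasurable φ.continuous.aestronglyMeasurable]

end MassTransport

/-! ### Curves as flows, and slope bounds from gradients along paths -/

namespace MassTransport

universe u

/-- Almost every rational path is `1`-Lipschitz, hence extends to real times by completeness. On the
exceptional set the path is declared constant, so the Lipschitz bound holds for every `ω`. -/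
theorem IsApproxTransport.exists_measure_path {Y : Type u} [MetricSpace Y] [CompactSpace Y]
    [MeasurableSpace Y] [BorelSpace Y] {ν : ℝ → Measure Y} {β : ℝ → ℝ} [Nonempty Y]
    [∀ t, IsProbabilityMeasure (ν t)]
    (h : IsApproxTransport ν β) (hβ0 : ∀ ε, 0 ≤ ε → 0 ≤ β ε)
    (hβ : Tendsto (fun ε => β ε / ε) (𝓝[>] 0) (𝓝 0)) {T : ℝ} (hT : 0 ≤ T) :
    ∃ (Q : Measure (ℚ → Y)) (x : ℝ → (ℚ → Y) → Y), IsProbabilityMeasure Q ∧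
      (Measurable fun p : ℝ × (ℚ → Y) => x p.1 p.2) ∧
      (∀ ω s t, dist (x s ω) (x t ω) ≤ |s - t|) ∧ ∀ t ∈ Icc 0 T, Q.map (x t) = ν t := by
  classical
  obtain ⟨Q, hQ, hLip, hmarg⟩ := h.exists_measure_rat_path hβ0 hβ hT
  obtain ⟨y₀⟩ := ‹Nonempty Y›
  set L : Set (ℚ → Y) := {ω | ∀ p q : ℚ, dist (ω p) (ω q) ≤ |(p : ℝ) - q|} with hL
  have hLm : MeasurableSet L := by
    rw [hL, ofPred_forall]
    refine MeasurableSet.iInter fun p => ?_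
    rw [ofPred_forall]
    exact MeasurableSet.iInter fun q => measurableSet_le
      ((measurable_pi_apply p).dist (measurable_pi_apply q)) measurable_const
  -- Rational approximations depending measurably on `t`; joint measurability of `x` is inherited in
  -- the limit.
  set a : ℕ → ℝ → ℚ := fun n t => (⌊t * (n + 1)⌋ : ℚ) / (n + 1) with ha
  have ham : ∀ n, Measurable (a n) := fun n =>
    (measurable_from_top (f := fun z : ℤ => (z : ℚ) / (n + 1))).comp
      (Int.measurable_floor.comp (measurable_id.mul_const ((n : ℝ) + 1)))
  have hat : ∀ n t, |t - a n t| ≤ 1 / ((n : ℝ) + 1) := by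
    intro n t
    have hn : (0 : ℝ) < n + 1 := by positivity
    have h1 := Int.floor_le (t * ((n : ℝ) + 1))
    have h2 := Int.lt_floor_add_one (t * ((n : ℝ) + 1))
    have h3 : t - a n t = (t * (n + 1) - ⌊t * ((n : ℝ) + 1)⌋) / (n + 1) := by
      simp only [ha]
      push_cast
      field_simp
    rw [h3, abs_div, abs_of_pos hn, abs_of_nonneg (by linarith)]
    gcongr
    linarith
  have hat' : ∀ t, Tendsto (fun n => (a n t : ℝ)) atTop (𝓝 t) := by
    intro t
    rw [tendsto_iff_dist_tendsto_zero]
    refine squeeze_zero (fun _ => dist_nonneg) (fun n => ?_)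
      (tendsto_one_div_add_atTop_nhds_zero_nat (𝕜 := ℝ))
    rw [dist_comm, Real.dist_eq]
    exact hat n t
  have hex : ∀ ω ∈ L, ∀ t : ℝ, ∃ y, ∀ q : ℚ, dist y (ω q) ≤ |t - q| := by
    intro ω hω t
    have hcau : CauchySeq fun n => ω (a n t) := by
      refine cauchySeq_of_le_tendsto_0 (fun n : ℕ => 1 / ((n : ℝ) + 1) + 1 / ((n : ℝ) + 1))
        (fun n m N hn hm => (hω _ _).trans ?_) ?_
      · have e1 := hat n t
        have e2 := hat m t
        have e3 : 1 / ((n : ℝ) + 1) ≤ 1 / ((N : ℝ) + 1) := Nat.one_div_le_one_div hn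
        have e4 : 1 / ((m : ℝ) + 1) ≤ 1 / ((N : ℝ) + 1) := Nat.one_div_le_one_div hm
        rw [abs_le] at *
        constructor <;> linarith [e1.1, e1.2, e2.1, e2.2]
      · simpa using (tendsto_one_div_add_atTop_nhds_zero_nat (𝕜 := ℝ)).add
          (tendsto_one_div_add_atTop_nhds_zero_nat (𝕜 := ℝ))
    obtain ⟨y, hy⟩ := cauchySeq_tendsto_of_complete hcau
    refine ⟨y, fun q => le_of_tendsto_of_tendsto (hy.dist tendsto_const_nhds)
      (((hat' t).sub_const _).abs) (Eventually.of_forall fun n => hω _ _)⟩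
  choose X hX using hex
  set x : ℝ → (ℚ → Y) → Y := fun t ω => if hω : ω ∈ L then X ω hω t else y₀ with hx
  have hxL : ∀ ω ∈ L, ∀ (t : ℝ) (q : ℚ), dist (x t ω) (ω q) ≤ |t - q| := fun ω hω t q => by
    simp only [hx, dif_pos hω]
    exact hX ω hω t q
  have hlim : ∀ ω ∈ L, ∀ t, Tendsto (fun n => ω (a n t)) atTop (𝓝 (x t ω)) := by
    intro ω hω t
    rw [tendsto_iff_dist_tendsto_zero]
    refine squeeze_zero (fun _ => dist_nonneg) (fun n => ?_)
      (tendsto_one_div_add_atTop_nhds_zero_nat (𝕜 := ℝ))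
    rw [dist_comm]
    exact (hxL ω hω t _).trans (hat n t)
  have hxm : Measurable fun p : ℝ × (ℚ → Y) => x p.1 p.2 := by
    have hev : Measurable fun p : (ℚ → Y) × ℚ => p.1 p.2 :=
      measurable_from_prod_countable_left fun q => measurable_pi_apply q
    refine measurable_of_tendsto_metrizable
      (f := fun (n : ℕ) (p : ℝ × (ℚ → Y)) => if p.2 ∈ L then p.2 (a n p.1) else y₀)
      (fun n => ?_) ?_
    · exact Measurable.ite (measurable_snd hLm)
        (hev.comp (measurable_snd.prodMk ((ham n).comp measurable_fst))) measurable_const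
    · rw [tendsto_pi_nhds]
      rintro ⟨t, ω⟩
      by_cases hω : ω ∈ L
      · simpa only [if_pos hω] using hlim ω hω t
      · simp only [hx, if_neg hω, dif_neg hω]
        exact tendsto_const_nhds
  have hxt : ∀ t, Measurable (x t) := fun t => hxm.comp (measurable_const.prodMk measurable_id)
  refine ⟨Q, x, hQ, hxm, fun ω s t => ?_, fun t ht => ?_⟩
  · by_cases hω : ω ∈ L
    · have h1 : Tendsto (fun n => |s - a n t| + |t - a n t|) atTop (𝓝 (|s - t| + |t - t|)) :=
        ((hat' t).const_sub s).abs.add ((hat' t).const_sub t).abs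
      rw [sub_self, abs_zero, add_zero] at h1
      refine ge_of_tendsto h1 (Eventually.of_forall fun n => ?_)
      exact (dist_triangle_right _ _ (ω (a n t))).trans
        (add_le_add (hxL ω hω s _) (hxL ω hω t _))
    · simp only [hx, dif_neg hω, dist_self]
      exact abs_nonneg _
  · have : IsProbabilityMeasure (Q.map (x t)) :=
      Measure.isProbabilityMeasure_map (hxt t).aemeasurable
    refine ext_of_forall_integral_eq_of_IsFiniteMeasure fun φ => ?_
    rw [integral_map (hxt t).aemeasurable φ.continuous.aestronglyMeasurable]
    have hcont := h.continuous_integral hβ0 (tendsto_of_tendsto_div hβ) φ.continuous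
    have h1 : Tendsto (fun n => ∫ ω, φ (ω (a n t)) ∂Q) atTop (𝓝 (∫ ω, φ (x t ω) ∂Q)) := by
      refine tendsto_integral_of_dominated_convergence (fun _ => ‖φ‖)
        (fun n => (φ.continuous.measurable.comp (measurable_pi_apply _)).aestronglyMeasurable)
        (integrable_const _) (fun n => ae_of_all _ fun ω => φ.norm_coe_le_norm _) ?_
      filter_upwards [hLip] with ω hω
      exact (φ.continuous.tendsto _).comp (hlim ω hω t)
    have h2 : ∀ n, ∫ ω, φ (ω (a n t)) ∂Q = ∫ y, φ y ∂(ν (max 0 (min T (a n t)))) := fun n => by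
      rw [← hmarg, integral_map (measurable_pi_apply _).aemeasurable
        φ.continuous.aestronglyMeasurable]
    simp only [h2] at h1
    have h3 : Tendsto (fun n => max 0 (min T (a n t : ℝ))) atTop (𝓝 (max 0 (min T t))) :=
      tendsto_const_nhds.max (tendsto_const_nhds.min (hat' t))
    rw [min_eq_right ht.2, max_eq_right ht.1] at h3
    exact tendsto_nhds_unique h1 ((hcont.tendsto t).comp h3)

variable {X : Type u} [MetricSpace X] [MeasurableSpace X] [BorelSpace X] {μ : Measure X}
  {f g : X → ℝ} {θ : ℝ → ℝ}

theorem PathGrad.abs_integral_sub_le (h : PathGrad μ f g) (hf : LocallyIntegrable f μ)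
    (hg : LocallyIntegrable g μ) (hgm : Measurable g) {K : Set X} {T : ℝ} {Ω : Type u}
    [MeasurableSpace Ω] {P : Measure Ω} {x : ℝ → Ω → X} (hK : IsCompact K)
    (hx : IsFlow μ K T P x) (hT : 0 < T) :
    |∫ ω, f (x T ω) ∂P - ∫ ω, f (x 0 ω) ∂P| ≤ ∫ r in (0 : ℝ)..T, (∫ ω, g (x r ω) ∂P) := by
  have hfK := hf.integrableOn_isCompact hK
  have hgK := hg.integrableOn_isCompact hK
  have := hx.finite
  have hgi : Integrable (fun ω => ∫ r in (0 : ℝ)..T, g (x r ω)) P := by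
    simp only [intervalIntegral.integral_of_le hT.le]
    exact (hx.integrable_prod hK hgm hgK le_rfl le_rfl).integral_prod_right
  rw [hx.integral_integral_swap hK hgm hgK le_rfl hT.le le_rfl,
    ← integral_sub (hx.integrable hK hfK ⟨hT.le, le_rfl⟩) (hx.integrable hK hfK ⟨le_rfl, hT.le⟩),
    ← Real.norm_eq_abs]
  refine norm_integral_le_of_norm_le hgi ?_
  filter_upwards [h K T Ω P x hK hT hx, hx.ae_intervalIntegrable hK hgm hgK hT.le] with ω hω hi
  obtain ⟨U, hU, hU0, hUT, -, hUd⟩ := hω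
  rw [Real.norm_eq_abs, ← hU0, ← hUT]
  exact abs_sub_le_integral_of_deriv_le hT.le hi hU hUd

variable [SecondCountableTopology X] [IsFiniteMeasureOnCompacts μ]

/-- A curve which stays in a compact set is the image of a measure on paths. -/
theorem IsCurve.exists_flow (hθ : IsMassGauge θ) {K : Set X} (hK : IsCompact K) {b T : ℝ}
    {γ : ℝ → massX μ} (hγ : IsCurve θ μ b γ) (hT : 0 ≤ T) (hTb : T ≤ b)
    (hmem : ∀ t ∈ Icc 0 T, ∀ᵐ y ∂(γ t : Measure X), y ∈ K) :
    ∃ (P : Measure (ℚ → K)) (x : ℝ → (ℚ → K) → X), IsFlow μ K T P x ∧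
      ∀ t ∈ Icc 0 T, P.map (x t) = γ t := by
  classical
  have hfin : ∀ r, IsFiniteMeasure (γ r : Measure X) := fun r =>
    isFiniteMeasure_of_mem_massM (γ r).2.1
  have h0T : (0 : ℝ) ∈ Icc 0 T := ⟨le_rfl, hT⟩
  set M : ℝ≥0∞ := (γ 0 : Measure X) univ with hM
  have hM0 : M ≠ 0 := fun h => (γ 0).2.2 (Measure.measure_univ_eq_zero.1 h)
  have hMt : M ≠ ⊤ := measure_ne_top _ _
  have hMpos : 0 < M.toReal := ENNReal.toReal_pos hM0 hMt
  have hsubT : Icc 0 T ⊆ Icc 0 b := Icc_subset_Icc_right hTb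
  have hmass : ∀ t ∈ Icc 0 T, (γ t : Measure X) univ = M := fun t ht =>
    hγ.measure_univ_eq hθ (hsubT ht) (hsubT h0T)
  have : CompactSpace K := isCompact_iff_compactSpace.1 hK
  have : (ae (γ 0 : Measure X)).NeBot := ae_neBot.2 (γ 0).2.2
  obtain ⟨k₀, hk₀⟩ := (hmem 0 h0T).exists
  have : Nonempty K := ⟨⟨k₀, hk₀⟩⟩
  -- A measurable map onto `K` fixing `K`; its arbitrary value elsewhere is harmless, as all `γ t`
  -- with `t` in `[0, T]` are concentrated on `K`.
  set r : X → K := fun y => if h : y ∈ K then ⟨y, h⟩ else ⟨k₀, hk₀⟩ with hr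
  have hrm : Measurable r := Measurable.dite (measurable_id) measurable_const hK.measurableSet
  have hrK : ∀ y ∈ K, (r y : X) = y := fun y hy => by simp [hr, hy]
  set c : ℝ → ℝ := fun t => projIcc 0 T hT t with hc
  have hcmem : ∀ t, c t ∈ Icc 0 T := fun t => (projIcc 0 T hT t).2
  have hcl : ∀ s t, |c s - c t| ≤ |s - t| := fun s t => abs_projIcc_sub_projIcc hT
  set ν : ℝ → Measure K := fun t => M⁻¹ • (γ (c t) : Measure X).map r with hν
  have hνp : ∀ t, IsProbabilityMeasure (ν t) := fun t => ⟨by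
    rw [hν, Measure.smul_apply, Measure.map_apply hrm MeasurableSet.univ, preimage_univ,
      hmass _ (hcmem t), smul_eq_mul, ENNReal.inv_mul_cancel hM0 hMt]⟩
  have happ : IsApproxTransport ν fun ε => θ ε / M.toReal := by
    intro s t ε hst
    obtain ⟨νs, ηs, hd⟩ := hγ.exists_isDecomposition hθ (hsubT (hcmem s)) (hsubT (hcmem t))
      ((hcl s t).trans_lt hst)
    obtain ⟨π, h1, h2, h3⟩ := hd.exists_coupling
      ((hmass _ (hcmem s)).trans (hmass _ (hcmem t)).symm)
    have hrr : Measurable (Prod.map r r) := hrm.prodMap hrm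
    refine ⟨M⁻¹ • π.map (Prod.map r r), ?_, ?_, ?_⟩
    · rw [Measure.fst, Measure.map_smul, Measure.map_map measurable_fst hrr,
        show ν s = M⁻¹ • (γ (c s) : Measure X).map r from rfl, ← h1,
        Measure.fst, Measure.map_map hrm measurable_fst]
      rfl
    · rw [Measure.snd, Measure.map_smul, Measure.map_map measurable_snd hrr,
        show ν t = M⁻¹ • (γ (c t) : Measure X).map r from rfl, ← h2,
        Measure.snd, Measure.map_map hrm measurable_snd]
      rfl
    · rw [Measure.smul_apply, smul_eq_mul, Measure.map_apply hrr
        (measurableSet_lt measurable_const measurable_dist)]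
      have e1 : ∀ᵐ p ∂π, p.1 ∈ K := by
        have := hmem _ (hcmem s)
        rw [← h1, Measure.fst] at this
        exact ae_of_ae_map measurable_fst.aemeasurable this
      have e2 : ∀ᵐ p ∂π, p.2 ∈ K := by
        have := hmem _ (hcmem t)
        rw [← h2, Measure.snd] at this
        exact ae_of_ae_map measurable_snd.aemeasurable this
      have hle : π (Prod.map r r ⁻¹' {p | ε < dist p.1 p.2}) ≤ ENNReal.ofReal (θ ε) := by
        refine le_trans (measure_mono_ae ?_) h3
        filter_upwards [e1, e2] with p hp1 hp2 hp
        change ε < dist (r p.1 : X) (r p.2 : X) at hp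
        rwa [hrK _ hp1, hrK _ hp2] at hp
      rw [ENNReal.ofReal_div_of_pos hMpos, ENNReal.ofReal_toReal hMt, ENNReal.div_eq_inv_mul]
      gcongr
  have hθ0 : ∀ ε, 0 ≤ ε → 0 ≤ θ ε / M.toReal := fun ε hε => by
    refine div_nonneg ?_ hMpos.le
    rw [← hθ.map_zero]
    exact hθ.strictMonoOn.monotoneOn (mem_Ici.2 le_rfl) hε hε
  have hθd : Tendsto (fun ε => θ ε / M.toReal / ε) (𝓝[>] 0) (𝓝 0) := by
    have := hθ.tendsto_div.div_const M.toReal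
    rw [zero_div] at this
    exact this.congr fun ε => div_right_comm _ _ _
  obtain ⟨Q, x, hQ, hxm, hxl, hxe⟩ := happ.exists_measure_path hθ0 hθd hT
  have hxt : ∀ t, Measurable (x t) := fun t => hxm.comp (measurable_const.prodMk measurable_id)
  have hlaw : ∀ t ∈ Icc 0 T, (M • Q).map (fun ω => (x t ω : X)) = γ t := by
    intro t ht
    have e1 : (fun ω => (x t ω : X)) = Subtype.val ∘ x t := rfl
    have e2 : c t = t := by simp only [hc, projIcc_of_mem hT ht]
    rw [Measure.map_smul, e1, ← Measure.map_map measurable_subtype_coe (hxt t), hxe t ht, hν,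
      Measure.map_smul, smul_smul, ENNReal.mul_inv_cancel hM0 hMt, one_smul,
      Measure.map_map measurable_subtype_coe hrm, e2]
    have e3 : Subtype.val ∘ r =ᵐ[(γ t : Measure X)] id := by
      filter_upwards [hmem t ht] with y hy using hrK y hy
    rw [Measure.map_congr e3, Measure.map_id]
  refine ⟨M • Q, fun t ω => x t ω, ⟨Q.smul_finite hMt, measurable_subtype_coe.comp hxm, hxl,
    fun ω t => (x t ω).2, fun t ht => ?_⟩, hlaw⟩
  rw [hlaw t ht]
  exact (γ t).2.1.1

/-- Curves starting at a given measure are, for a short time, images of measures on paths in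
a fixed compact set. -/
theorem exists_flow_of_curve [LocallyCompactSpace X] (hθ : IsMassGauge θ) (η : massX μ) :
    ∃ K : Set X, IsCompact K ∧ ∃ ρ > 0, ∀ (b T : ℝ) (γ : ℝ → massX μ), IsCurve θ μ b γ →
      γ 0 = η → 0 ≤ T → T < ρ → T ≤ b →
      ∃ (P : Measure (ℚ → K)) (x : ℝ → (ℚ → K) → X), IsFlow μ K T P x ∧
        ∀ t ∈ Icc 0 T, P.map (x t) = γ t := by
  obtain ⟨ρ, hρ, hK⟩ := η.2.1.2.exists_isCompact_cthickening
  refine ⟨_, hK, ρ, hρ, fun b T γ hγ hγ0 hT hTρ hTb => hγ.exists_flow hθ hK hT hTb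
    fun t ht => ?_⟩
  rw [← hγ0]
  exact hγ.ae_mem_cthickening hθ ⟨ht.1, ht.2.trans hTb⟩ (ht.2.trans_lt hTρ)

/-- Represent each short curve by a flow and integrate the derivative bound over its paths. As `s →
0`, the time average of the mean of `g` tends to its initial value. -/
theorem PathGrad.dominatesSlope [LocallyCompactSpace X] (hθ : IsMassGauge θ)
    (h : PathGrad μ f g) (hf : LocallyIntegrable f μ) (hg : LocallyIntegrable g μ)
    (hgm : Measurable g) (hg0 : ∀ y, 0 ≤ g y) : DominatesSlope θ μ f g := by
  refine ⟨hg, fun η => ?_⟩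
  obtain ⟨K, hK, ρ, hρ, hflow⟩ := exists_flow_of_curve hθ η
  have hfK := hf.integrableOn_isCompact hK
  have hgK := hg.integrableOn_isCompact hK
  have hηf : IsFiniteMeasure (η : Measure X) := isFiniteMeasure_of_mem_massM η.2.1
  set M := (η : Measure X).real univ
  have hM : 0 < M := real_univ_pos_of_ne_zero η.2.2
  have hF0 : 0 ≤ meanValue μ g η :=
    mul_nonneg (inv_nonneg.2 measureReal_nonneg) (integral_nonneg hg0)
  suffices hle : slope θ μ (meanValue μ f) η ≤ ENNReal.ofReal (meanValue μ g η) by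
    calc (slope θ μ (meanValue μ f) η : EReal)
        ≤ (ENNReal.ofReal (meanValue μ g η) : EReal) := EReal.coe_ennreal_le_coe_ennreal_iff.2 hle
      _ = ((meanValue μ g η : ℝ) : EReal) := by
          rw [EReal.coe_ennreal_ofReal, max_eq_left hF0]
  refine ENNReal.le_of_forall_pos_le_add fun δ hδ _ => ?_
  -- The slope is a supremum over all curves, so the modulus must be chosen before the curve; it
  -- depends only on `K`, `g` and the mass `M`.
  obtain ⟨ε, hε, hmod⟩ := IsFlow.exists_modulus (μ := μ) hK hgK M
    (show (0 : ℝ) < M * δ by positivity)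
  refine (iInf₂_le (min ε ρ) (lt_min hε hρ)).trans (sSup_le ?_)
  rintro _ ⟨b, γ, s, hγ, hγ0, hs, hsb, rfl⟩
  have hsε : s < ε := hsb.trans_le ((min_le_left _ _).trans (min_le_left _ _))
  have hsρ : s < ρ := hsb.trans_le ((min_le_left _ _).trans (min_le_right _ _))
  have hsb : s ≤ b := (hsb.trans_le (min_le_right _ _)).le
  obtain ⟨P, x, hx, hlaw⟩ := hflow b s γ hγ hγ0 hs.le hsρ hsb
  have h0s : (0 : ℝ) ∈ Icc 0 s := ⟨le_rfl, hs.le⟩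
  have hss : s ∈ Icc 0 s := ⟨hs.le, le_rfl⟩
  have hmass : (γ s : Measure X).real univ = M := by
    rw [measureReal_def, ← hγ.measure_univ_eq hθ ⟨le_rfl, hγ.1⟩ ⟨hs.le, hsb⟩, hγ0]
    rfl
  have hP : P.real univ = M := by
    have := hlaw 0 h0s
    rw [hγ0] at this
    rw [show M = (η : Measure X).real univ from rfl, ← this, measureReal_def, measureReal_def,
      Measure.map_apply (hx.measurable_eval 0) MeasurableSet.univ, preimage_univ]
  have e0 : ∀ {k : X → ℝ}, IntegrableOn k K μ → ∫ y, k y ∂(η : Measure X) = ∫ ω, k (x 0 ω) ∂P :=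
    fun {k} hk => by rw [← hx.integral_map_eval hK hk h0s, hlaw 0 h0s, hγ0]
  have es : ∫ y, f y ∂(γ s : Measure X) = ∫ ω, f (x s ω) ∂P := by
    rw [← hx.integral_map_eval hK hfK hss, hlaw s hss]
  have hbound : ∫ r in (0 : ℝ)..s, (∫ ω, g (x r ω) ∂P) ≤
      s * (∫ ω, g (x 0 ω) ∂P + M * δ) := by
    have hcont := hx.continuousOn_integral hK hgK
    rw [← uIcc_of_le hs.le] at hcont
    have := intervalIntegral.integral_mono_on hs.le hcont.intervalIntegrable
      (intervalIntegrable_const (μ := volume) (a := 0) (b := s) (c := ∫ ω, g (x 0 ω) ∂P + M * δ)) fun r hr => by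
        have := hmod hx hP.le r hr 0 h0s (by
          rw [sub_zero, abs_of_nonneg hr.1]
          exact hr.2.trans_lt hsε)
        linarith [(abs_le.1 this).2]
    rwa [intervalIntegral.integral_const, sub_zero, smul_eq_mul] at this
  rw [← ENNReal.ofReal_coe_nnreal, ← ENNReal.ofReal_add hF0 δ.coe_nonneg]
  refine ENNReal.ofReal_le_ofReal ?_
  rw [div_le_iff₀ hs]
  simp only [meanValue]
  rw [hmass, es, e0 hfK, e0 hgK, show (η : Measure X).real univ = M from rfl, ← mul_sub, abs_mul,
    abs_of_pos (inv_pos.2 hM)]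
  calc M⁻¹ * |∫ ω, f (x s ω) ∂P - ∫ ω, f (x 0 ω) ∂P|
      ≤ M⁻¹ * (s * (∫ ω, g (x 0 ω) ∂P + M * δ)) := by
        gcongr
        exact (h.abs_integral_sub_le hf hg hgm hK hx hs).trans hbound
    _ = (M⁻¹ * ∫ ω, g (x 0 ω) ∂P + δ) * s := by
        field_simp

end MassTransport

/-! ### Minimal gradients along paths -/

namespace MassTransport

universe u

variable {X : Type u} [MetricSpace X] [MeasurableSpace X] {μ : Measure X} {θ : ℝ → ℝ}
  {f f' g g' : X → ℝ}

theorem meanValue_congr (h : f =ᵐ[μ] f') : meanValue μ f = meanValue μ f' := by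
  funext η
  rw [meanValue, meanValue, integral_congr_ae (ae_mono η.2.1.1 h)]

theorem DominatesSlope.congr (h : DominatesSlope θ μ f g) (hf : f =ᵐ[μ] f') (hg : g =ᵐ[μ] g') :
    DominatesSlope θ μ f' g' := by
  refine ⟨h.1.congr hg, fun η => ?_⟩
  rw [← meanValue_congr hf, ← meanValue_congr hg]
  exact h.2 η

variable (μ) in
/-- Measurable nonnegative functions in `L¹_loc` which bound the derivatives of `f` along paths. -/
structure IsPathGradient (f g : X → ℝ) : Prop where
  measurable : Measurable g
  nonneg : ∀ y, 0 ≤ g y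
  locallyIntegrable : LocallyIntegrable g μ
  pathGrad : PathGrad μ f g

theorem IsPathGradient.of_le {g₁ g₂ : X → ℝ} (h : IsPathGradient μ f g₁) (hm : Measurable g₂)
    (h0 : ∀ y, 0 ≤ g₂ y) (hle : ∀ y, g₂ y ≤ g₁ y) (hg₂ : PathGrad μ f g₂) :
    IsPathGradient μ f g₂ :=
  ⟨hm, h0, h.locallyIntegrable.mono hm.aestronglyMeasurable (ae_of_all _ fun y => by
    rw [Real.norm_of_nonneg (h0 y)]
    exact (hle y).trans (le_abs_self _)), hg₂⟩

/-- Local integrability is inherited from `g₁` alone, so part 1 needs none for `|f| g_h + |h| g_f`.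
-/
theorem IsPathGradient.min {g₁ g₂ : X → ℝ} (h : IsPathGradient μ f g₁) (hm : Measurable g₂)
    (h0 : ∀ y, 0 ≤ g₂ y) (hg₂ : PathGrad μ f g₂) :
    IsPathGradient μ f fun y => min (g₁ y) (g₂ y) := by
  refine h.of_le (h.measurable.min hm) (fun y => le_min (h.nonneg y) (h0 y))
    (fun y => min_le_left _ _) ?_
  refine PathGrad.of_countable (G := fun b : Bool => cond b g₁ g₂) ?_ fun y c hc =>
    le_min (hc true) (hc false)
  rintro (_ | _)
  · exact hg₂
  · exact h.pathGrad

/-- There is a smallest bound of the derivatives along paths, as soon as there is one. -/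
theorem IsPathGradient.exists_minimal [OpensMeasurableSpace X] [SecondCountableTopology X]
    [IsLocallyFiniteMeasure μ] (h : IsPathGradient μ f g) :
    ∃ g₀, IsPathGradient μ f g₀ ∧ ∀ g', IsPathGradient μ f g' → g₀ ≤ᵐ[μ] g' := by
  -- A finite functional, strictly monotone modulo null sets on nonnegative functions. The infimum
  -- `g₀` of a minimising sequence is admissible, and so is its minimum with any competitor;
  -- equality of `J` then forces `g₀` below the competitor.
  set J : (X → ℝ) → ℝ≥0∞ := fun k => ∫⁻ y, ENNReal.ofReal (Real.arctan (k y)) ∂μ.toFinite with hJ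
  have hJmono : ∀ {k k' : X → ℝ}, (∀ y, k y ≤ k' y) → J k ≤ J k' := fun hkk' =>
    lintegral_mono fun y => ENNReal.ofReal_le_ofReal (Real.arctan_strictMono.monotone (hkk' y))
  have hne : (J '' {k | IsPathGradient μ f k}).Nonempty := ⟨_, g, h, rfl⟩
  obtain ⟨v, -, hv, hvmem⟩ := exists_seq_tendsto_sInf hne (OrderBot.bddBelow _)
  choose k hk hkv using hvmem
  have hbdd : ∀ y, BddBelow (range fun n => k n y) := fun y =>
    ⟨0, by rintro _ ⟨n, rfl⟩; exact (hk n).nonneg y⟩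
  set g₀ : X → ℝ := fun y => ⨅ n, k n y with hg₀
  have hg₀le : ∀ n y, g₀ y ≤ k n y := fun n y => ciInf_le (hbdd y) n
  have hg₀P : IsPathGradient μ f g₀ :=
    (hk 0).of_le (Measurable.iInf fun n => (hk n).measurable)
      (fun y => le_ciInf fun n => (hk n).nonneg y) (hg₀le 0)
      (PathGrad.of_countable (fun n => (hk n).pathGrad) fun y c hc => le_ciInf hc)
  have hJg₀ : J g₀ ≤ sInf (J '' {k | IsPathGradient μ f k}) :=
    ge_of_tendsto hv (Eventually.of_forall fun n => by
      rw [← hkv n]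
      exact hJmono (hg₀le n))
  refine ⟨g₀, hg₀P, fun g' hg' => ?_⟩
  have hmin := hg₀P.min hg'.measurable hg'.nonneg hg'.pathGrad
  have hfin : J (fun y => Min.min (g₀ y) (g' y)) ≠ ⊤ := by
    refine ne_top_of_le_ne_top ?_ (lintegral_mono (g := fun _ => ENNReal.ofReal (Real.pi / 2))
      fun y => ENNReal.ofReal_le_ofReal (Real.arctan_lt_pi_div_two _).le)
    rw [lintegral_const]
    exact ENNReal.mul_ne_top ENNReal.ofReal_ne_top (measure_ne_top _ _)
  have heq := ae_eq_of_ae_le_of_lintegral_le (μ := μ.toFinite)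
    (ae_of_all _ fun y => ENNReal.ofReal_le_ofReal
      (Real.arctan_strictMono.monotone (min_le_left (g₀ y) (g' y)))) hfin
    (Real.measurable_arctan.comp hg₀P.measurable).ennreal_ofReal.aemeasurable
    (hJg₀.trans (sInf_le ⟨_, hmin, rfl⟩))
  rw [Filter.EventuallyEq, ae_toFinite] at heq
  filter_upwards [heq] with y hy
  have harc : ∀ {a : ℝ}, 0 ≤ a → 0 ≤ Real.arctan a := fun ha => by
    rw [← Real.arctan_zero]
    exact Real.arctan_strictMono.monotone ha
  have := Real.arctan_strictMono.injective
    ((ENNReal.ofReal_eq_ofReal_iff (harc (hmin.nonneg y)) (harc (hg₀P.nonneg y))).1 hy)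
  exact min_eq_left_iff.1 this

variable [BorelSpace X] [SecondCountableTopology X]

theorem DominatesSlope.isPathGradient [IsFiniteMeasureOnCompacts μ]
    (h : DominatesSlope θ μ f g) (hf : LocallyIntegrable f μ)
    (hfm : Measurable f) (hgm : Measurable g) (hg0 : ∀ y, 0 ≤ g y) : IsPathGradient μ f g :=
  ⟨hgm, hg0, h.1, h.pathGrad hf hfm hgm hg0⟩

variable [LocallyCompactSpace X]

theorem DominatesSlope.ae_nonneg (h : DominatesSlope θ μ f g) : ∀ᵐ y ∂μ, 0 ≤ g y :=
  ae_le_of_meanValue_le (locallyIntegrable_zero) h.1 fun η => by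
    have h0 : meanValue μ (fun _ => (0 : ℝ)) η = 0 := by simp [meanValue]
    refine h0.le.trans ?_
    have : (0 : EReal) ≤ ((meanValue μ g η : ℝ) : EReal) :=
      (EReal.coe_ennreal_nonneg _).trans (h.2 η)
    exact_mod_cast this

/-- Fubini along paths uses Borel functions, while slope domination sees only almost everywhere
classes. -/
theorem DominatesSlope.exists_representative (h : DominatesSlope θ μ f g) :
    ∃ g', Measurable g' ∧ (∀ y, 0 ≤ g' y) ∧ g =ᵐ[μ] g' := by
  have hm := h.1.aestronglyMeasurable
  refine ⟨fun y => max 0 (hm.mk g y), measurable_const.max hm.stronglyMeasurable_mk.measurable,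
    fun y => le_max_left _ _, ?_⟩
  filter_upwards [h.ae_nonneg, hm.ae_eq_mk] with y h1 h2
  rw [← h2, max_eq_right h1]

theorem IsPathGradient.dominatesSlope [IsFiniteMeasureOnCompacts μ] (hθ : IsMassGauge θ) (hf : LocallyIntegrable f μ)
    (h : IsPathGradient μ f g) : DominatesSlope θ μ f g :=
  h.pathGrad.dominatesSlope hθ hf h.locallyIntegrable h.measurable h.nonneg

end MassTransport

/-! ### The Leibniz rule -/

theorem mainTheorem5 {X : Type*} [MetricSpace X] [TopologicalSpace.SeparableSpace X]
    [LocallyCompactSpace X] [MeasurableSpace X] [BorelSpace X] (μ : MeasureTheory.Measure X)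
    (hμ : ∀ (x : X) (r : ℝ), 0 < r → 0 < μ (Metric.ball x r) ∧ μ (Metric.ball x r) < ⊤)
    (θ : ℝ → ℝ) (hθ : MassTransport.IsMassGauge θ) (f h gf gh : X → ℝ)
    (hf : MeasureTheory.LocallyIntegrable f μ) (hh : MeasureTheory.LocallyIntegrable h μ)
    (hfh : MeasureTheory.LocallyIntegrable (fun x => f x * h x) μ)
    (hgf : MassTransport.IsUpperGradient θ μ f gf)
    (hgh : MassTransport.IsUpperGradient θ μ h gh) :
    (∀ g : X → ℝ, MassTransport.IsUpperGradient θ μ (fun x => f x * h x) g →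
      ∀ᵐ x ∂μ, g x ≤ |f x| * gh x + |h x| * gf x) ∧
    (MeasureTheory.LocallyIntegrable (fun x => |f x| * gh x + |h x| * gf x) μ →
      ∃ g : X → ℝ, MassTransport.IsUpperGradient θ μ (fun x => f x * h x) g) := by
  open MassTransport in
  have := UniformSpace.secondCountable_of_separable X
  have : IsLocallyFiniteMeasure μ :=
    ⟨fun x => ⟨_, Metric.ball_mem_nhds x one_pos, (hμ x 1 one_pos).2⟩⟩
  have hfm := hf.aestronglyMeasurable
  have hhm := hh.aestronglyMeasurable
  set f' := hfm.mk f
  set h' := hhm.mk h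
  have hf'm : Measurable f' := hfm.stronglyMeasurable_mk.measurable
  have hh'm : Measurable h' := hhm.stronglyMeasurable_mk.measurable
  have hff' : f =ᵐ[μ] f' := hfm.ae_eq_mk
  have hhh' : h =ᵐ[μ] h' := hhm.ae_eq_mk
  obtain ⟨gf', hgf'm, hgf'0, hgf'e⟩ := hgf.1.exists_representative
  obtain ⟨gh', hgh'm, hgh'0, hgh'e⟩ := hgh.1.exists_representative
  have hmul : (fun x => f x * h x) =ᵐ[μ] fun x => f' x * h' x := by
    filter_upwards [hff', hhh'] with x h1 h2
    rw [h1, h2]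
  have hmulm : Measurable fun x => f' x * h' x := hf'm.mul hh'm
  have hmuli : LocallyIntegrable (fun x => f' x * h' x) μ := hfh.congr hmul
  set G : X → ℝ := fun x => |f' x| * gh' x + |h' x| * gf' x
  have hGm : Measurable G := (hf'm.abs.mul hgh'm).add (hh'm.abs.mul hgf'm)
  have hG0 : ∀ x, 0 ≤ G x := fun x =>
    add_nonneg (mul_nonneg (abs_nonneg _) (hgh'0 x)) (mul_nonneg (abs_nonneg _) (hgf'0 x))
  have hGe : (fun x => |f x| * gh x + |h x| * gf x) =ᵐ[μ] G := by
    filter_upwards [hff', hhh', hgf'e, hgh'e] with x h1 h2 h3 h4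
    simp only [G, h1, h2, h3, h4]
  have hGP : PathGrad μ (fun x => f' x * h' x) G :=
    ((hgf.1.congr hff' hgf'e).pathGrad (hf.congr hff') hf'm hgf'm hgf'0).mul
      ((hgh.1.congr hhh' hgh'e).pathGrad (hh.congr hhh') hh'm hgh'm hgh'0)
  refine ⟨fun g hg => ?_, fun hGi => ?_⟩
  · obtain ⟨g', hg'm, hg'0, hg'e⟩ := hg.1.exists_representative
    -- The minimum of `g'` and `G` competes with `g` in the definition of the upper gradient, so `g`
    -- lies below it and hence below `G`.
    have hmin := ((hg.1.congr hmul hg'e).isPathGradient hmuli hmulm hg'm hg'0).min hGm hG0 hGP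
    filter_upwards [hg.2 _ ((hmin.dominatesSlope hθ hmuli).congr hmul.symm .rfl), hGe] with x h1 h2
    rw [h2]
    exact h1.trans (min_le_right _ _)
  · obtain ⟨g, hg, hgmin⟩ :=
      IsPathGradient.exists_minimal (⟨hGm, hG0, hGi.congr hGe, hGP⟩ : IsPathGradient μ _ G)
    refine ⟨g, (hg.dominatesSlope hθ hmuli).congr hmul.symm .rfl, fun k hk => ?_⟩
    obtain ⟨k', hk'm, hk'0, hk'e⟩ := hk.exists_representative
    exact (hgmin k' ((hk.congr hmul hk'e).isPathGradient hmuli hmulm hk'm hk'0)).trans_eq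
      hk'e.symm
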